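/- Conventions. Let $q=p^\ell$ be a power of a prime $p$. A stabilizer matrix is a polynomial matrix $S(D)=(X(D)\,|\,Z(D))\in\mathbb F_q[D]^{r\times 2n}$; it defines a quantum convolutional code of frame size $n$ if it has full rank $r$ and $X(D)Z(1/D)^t-Z(D)X(1/D)^t=0$ (a block code if all entries are constants). Its constraint length is $\nu=\sum_i\max_j\max(\deg X_{ij},\deg Z_{ij})$. Two stabilizer matrices define the same stabilizer if their rows span the same $\mathbb F_q[D,D^{-1}]$-module. A polynomial matrix $G(D)$ is non-catastrophic if every power series vector $u(D)$ for which $u(D)G(D)$ has finite weight has finite weight, and delay-free if $G(0)$ has full row rank. A circuit is a finite sequence of layers. Each layer consists of generalized Clifford gates acting on disjoint qudits of the frame, and every gate is applied together with all its translates by frames. The gates act on rows $(x(D)|z(D))$, on the columns concerned, by right multiplication with the following matrices: the Fourier transform $\begin{pmatrix}0&-1\\1&0\end{pmatrix}$; the multiplication gate $\begin{pmatrix}\gamma^{-1}&0\\0&\gamma\end{pmatrix}$ with $\gamma\in\mathbb F_q^*$; the diagonal gate $\begin{pmatrix}1&\gamma\\0&1\end{pmatrix}$ with $\gamma\in\mathbb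 F_q$; the gate $\mathrm{ADD}$ from qudit $i$ to qudit $j\neq i$ that is $l\in\mathbb Z$ frames later, acting by $\begin{pmatrix}1&D^l\\0&1\end{pmatrix}$ on the $X$-part and $\begin{pmatrix}1&0\\-D^{-l}&1\end{pmatrix}$ on the $Z$-part; and the controlled phase gate between copies of a qudit $l\neq0$ frames apart, acting by $\begin{pmatrix}1&D^l+D^{-l}\\0&1\end{pmatrix}$. The depth of a circuit is its number of time steps (a layer takes one step, or two if it contains a controlled phase gate); it does not depend on the length of the stream. An encoding circuit for $S(D)$ is a circuit that transforms the stabilizer $(0\,|\,I\;0)$ of $r$ ancilla qudits per frame, in suitable positions, into the stabilizer of $S(D)$. Theorem. There is a polynomial $P(n,\nu)$, independent of all other data, with the following property. Let $G_1(D)\in\mathbb F_p[D]^{k_1\times n_1}$, $k_1\ge1$, be a non-catastrophic, delay-free generator matrix of a classical convolutional code, and let $S_2=(X|Z)\in\mathbb F_q[D]^{r\times 2n_2}$ be the stabilizer matrix of a quantum block code or of a quantum convolutional code with $S_2$ non-catastrophic. Let $n=n_1n_2$ be the frame size and $\nu$ the constraint length of the quantum convolutional code with stabilizer matrix $G_1(D)\otimes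 S_2=(G_1(D)\otimes X\,|\,G_1(D)\otimes Z)$. Then this code has an encoding circuit of finite depth, independent of the length of the input stream, and the depth is at most $P(n,\nu)$. More precisely, there are an encoding circuit for the CSS-type stabilizer $(G_1(D)\,|\,0)$ on $n_1$ qudits per frame, and a circuit on $n_2$ qudits per frame that transforms the $X$-only stabilizer $(I\;0\,|\,0)$ into that of $S_2$ (so that preceded by Fourier transforms on the $r$ ancillae it is an encoding circuit for $S_2$), such that the following is an encoding circuit for $G_1(D)\otimes S_2$ of depth at most $P(n,\nu)$: index the qudits of a frame by pairs $(i,j)$, $i\le n_1$, $j\le n_2$; first apply $r$ interleaved copies of the former circuit, one for each of the $r$ ancilla positions $j$ of the latter, acting on the qudits $(\cdot,j)$; then apply the latter circuit to each of the $n_1$ blocks $(i,\cdot)$. -/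

import Mathlib

open Polynomial LaurentPolynomial

namespace QConv

/-! ### Convolutional encoders -/

/-- A polynomial matrix `G(D)` is non-catastrophic: an input stream whose output stream `u(D) G(D)`
has finite weight has itself finite weight. (A power series of finite weight is a polynomial.) -/
def NonCatastrophic {F ρ κ : Type*} [Field F] [Fintype ρ] (G : Matrix ρ κ F[X]) : Prop :=
  ∀ u : ρ → PowerSeries F,
    (∀ j, ∃ f : F[X], ∑ i, u i * (G i j : PowerSeries F) = (f : PowerSeries F)) →
      ∀ i, ∃ f : F[X], u i = (f : PowerSeries F)

/-- A polynomial matrix `G(D)` is delay-free: `G(0)` has full row rank. -/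
def DelayFree {F ρ κ : Type*} [Field F] (G : Matrix ρ κ F[X]) : Prop :=
  LinearIndependent F (fun (i : ρ) (j : κ) => (G i j).coeff 0)

/-! ### Stabilizer matrices -/

/-- A polynomial matrix `S(D) = (X(D) | Z(D))`; its rows are indexed by `ρ` and the qudits of one
frame by `ι`. -/
structure Stabilizer (F ρ ι : Type*) [Field F] where
  X : Matrix ρ ι F[X]
  Z : Matrix ρ ι F[X]

/-- Row vectors `(x(D) | z(D))` over the ring of Laurent polynomials in `D`: the coefficient of
`D ^ t` in `x i` and `z i` gives the Pauli matrix on qudit `i` of frame `t`. -/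
abbrev PauliRow (F ι : Type*) [Field F] : Type _ := (ι → F[T;T⁻¹]) × (ι → F[T;T⁻¹])

namespace Stabilizer

variable {F ρ ι : Type*} [Field F]

/-- The matrix `(X(D) | Z(D))` with its `2n` columns. -/
def toMatrix (S : Stabilizer F ρ ι) : Matrix ρ (ι ⊕ ι) F[X] := Matrix.fromCols S.X S.Z

/-- The condition `X(D) Z(1/D)ᵗ - Z(D) X(1/D)ᵗ = 0`. -/
def SelfOrthogonal [Fintype ι] (S : Stabilizer F ρ ι) : Prop :=
  ∀ i j : ρ, ∑ k, (toLaurent (S.X i k) * invert (toLaurent (S.Z j k))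
    - toLaurent (S.Z i k) * invert (toLaurent (S.X j k))) = 0

/-- `S(D)` defines a quantum convolutional code: full rank and self-orthogonal. -/
def IsQCC [Fintype ι] (S : Stabilizer F ρ ι) : Prop :=
  LinearIndependent F[X] S.toMatrix.row ∧ S.SelfOrthogonal

/-- `S` is the stabilizer matrix of a block code: all its entries are constants. -/
def IsBlock (S : Stabilizer F ρ ι) : Prop :=
  ∀ i j, (S.X i j).natDegree = 0 ∧ (S.Z i j).natDegree = 0

/-- The overall constraint length: the sum over the rows of the maximal degree in the row. -/
def constraintLength [Fintype ρ] [Fintype ι] (S : Stabilizer F ρ ι) : ℕ :=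
  ∑ i, Finset.univ.sup fun j => max (S.X i j).natDegree (S.Z i j).natDegree

/-- A row of `S(D)`. -/
noncomputable def row (S : Stabilizer F ρ ι) (i : ρ) : PauliRow F ι :=
  (fun j => toLaurent (S.X i j), fun j => toLaurent (S.Z i j))

/-- The stabilizer generated by the rows of `S(D)` and all their shifts by frames. -/
noncomputable def rowSpace (S : Stabilizer F ρ ι) : Submodule F[T;T⁻¹] (PauliRow F ι) :=
  Submodule.span _ (Set.range S.row)

/-- The trivial `Z`-only stabilizer `(0 | I 0)` of ancillae in the state `|0⟩`; the ancilla that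
belongs to row `i` is qudit `a i` of the frame. -/
noncomputable def trivialZ [DecidableEq ι] (a : ρ ↪ ι) : Stabilizer F ρ ι where
  X := 0
  Z := Matrix.of fun i j => if j = a i then 1 else 0

/-- The trivial `X`-only stabilizer `(I 0 | 0)`, with the same convention. -/
noncomputable def trivialX [DecidableEq ι] (a : ρ ↪ ι) : Stabilizer F ρ ι where
  X := Matrix.of fun i j => if j = a i then 1 else 0
  Z := 0

/-- The `X`-only stabilizer `(G(D) | 0)` of CSS type, for `G(D)` over a subfield `K` of `F`. -/
noncomputable def ofX {K : Type*} [Field K] [Algebra K F] (G : Matrix ρ ι K[X]) :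
    Stabilizer F ρ ι where
  X := G.map (Polynomial.map (algebraMap K F))
  Z := 0

/-- The product `G(D) ⊗ S = (G(D) ⊗ X | G(D) ⊗ Z)`, a Kronecker product of matrices, for `G(D)`
over a subfield `K` of `F`. -/
noncomputable def product {K ρ' ι' : Type*} [Field K] [Algebra K F] (G : Matrix ρ' ι' K[X])
    (S : Stabilizer F ρ ι) : Stabilizer F (ρ' × ρ) (ι' × ι) where
  X := Matrix.kroneckerMap (fun g s => g.map (algebraMap K F) * s) G S.X
  Z := Matrix.kroneckerMap (fun g s => g.map (algebraMap K F) * s) G S.Z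

end Stabilizer

/-! ### Circuits of generalized Clifford gates -/

/-- The generalized Clifford gates. Each of them stands for the gate together with all its
translates by frames:
* `dft i`, `mul γ i`, `phase γ i` act on qudit `i` of every frame;
* `add i j _ l` acts on qudit `i` of frame `t` (source) and qudit `j` of frame `t + l` (target),
  for all `t`;
* `cphase i l _` acts on qudit `i` of frame `t` and qudit `i` of frame `t + l`, for all `t`. -/
inductive Gate (F ι : Type*) [Field F] where
  | dft (i : ι)
  | mul (γ : Fˣ) (i : ι)
  | phase (γ : F) (i : ι)
  | add (i j : ι) (hij : i ≠ j) (l : ℤ)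
  | cphase (i : ι) (l : ℤ) (hl : l ≠ 0)

namespace Gate

variable {F ι κ : Type*} [Field F]

/-- The qudits of the frame on which the gate acts. -/
def wires : Gate F ι → Set ι
  | dft i => {i}
  | mul _ i => {i}
  | phase _ i => {i}
  | add i j _ _ => {i, j}
  | cphase i _ _ => {i}

/-- The number of time steps that the gate and all its translates need. The translates act on
pairwise disjoint sets of qudits, so that one step suffices, except for `cphase i l _`: there each
qudit belongs to the two pairs `{t - l, t}` and `{t, t + l}` of frames. These pairs form paths, so
that two steps are necessary and sufficient. -/
def duration : Gate F ι → ℕ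
  | cphase _ _ _ => 2
  | _ => 1

/-- The action of conjugation by the gate on row vectors `(x(D) | z(D))`. On the columns concerned
it is multiplication from the right by
* `dft`: `(0, -1; 1, 0)`;
* `mul γ`: `(γ⁻¹, 0; 0, γ)`;
* `phase γ`: `(1, γ; 0, 1)`;
* `add`: `(1, D ^ l; 0, 1)` on the `X`-part and `(1, 0; -D ^ (-l), 1)` on the `Z`-part;
* `cphase`: `(1, D ^ l + D ^ (-l); 0, 1)`. -/
noncomputable def act [DecidableEq ι] : Gate F ι → PauliRow F ι → PauliRow F ι
  | dft i, (x, z) => (Function.update x i (z i), Function.update z i (-x i))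
  | mul γ i, (x, z) =>
      (Function.update x i (LaurentPolynomial.C (↑γ⁻¹ : F) * x i),
        Function.update z i (LaurentPolynomial.C (γ : F) * z i))
  | phase γ i, (x, z) => (x, Function.update z i (z i + LaurentPolynomial.C γ * x i))
  | add i j _ l, (x, z) =>
      (Function.update x j (x j + T l * x i), Function.update z i (z i - T (-l) * z j))
  | cphase i l _, (x, z) => (x, Function.update z i (z i + (T l + T (-l)) * x i))

/-- The same gate on other qudits. -/
def map (f : ι ↪ κ) : Gate F ι → Gate F κ
  | dft i => dft (f i)
  | mul γ i => mul γ (f i)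
  | phase γ i => phase γ (f i)
  | add i j h l => add (f i) (f j) (f.injective.ne h) l
  | cphase i l h => cphase (f i) l h

theorem wires_map (f : ι ↪ κ) (g : Gate F ι) : (g.map f).wires = f '' g.wires := by
  cases g <;> simp [map, wires, Set.image_pair]

end Gate

/-- Gates that are applied in parallel: they act on pairwise disjoint sets of qudits. -/
structure Layer (F ι : Type*) [Field F] where
  gates : List (Gate F ι)
  disjoint : gates.Pairwise fun g h => Disjoint g.wires h.wires

namespace Layer

variable {F ι κ : Type*} [Field F]

/-- The number of time steps of a layer: the longest duration of its gates. -/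
def duration (L : Layer F ι) : ℕ := (L.gates.map Gate.duration).foldr max 0

/-- The action of a layer (the order of the gates does not matter, as they commute). -/
noncomputable def act [DecidableEq ι] (L : Layer F ι) (v : PauliRow F ι) : PauliRow F ι :=
  L.gates.foldl (fun w g => g.act w) v

/-- The same layer on other qudits. -/
def map (f : ι ↪ κ) (L : Layer F ι) : Layer F κ where
  gates := L.gates.map (Gate.map f)
  disjoint := by
    refine List.Pairwise.map _ (fun g h hgh => ?_) L.disjoint
    rw [Gate.wires_map, Gate.wires_map]
    exact (Set.disjoint_image_iff f.injective).2 hgh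

end Layer

/-- A circuit: finitely many layers, applied one after the other to the whole stream. It is the
same for streams of any length. -/
abbrev Circuit (F ι : Type*) [Field F] : Type _ := List (Layer F ι)

namespace Circuit

variable {F ρ ι κ : Type*} [Field F]

/-- The depth of a circuit: its number of time steps. -/
def depth (c : Circuit F ι) : ℕ := (List.map Layer.duration c).sum

/-- The action of a circuit; the head of the list is the layer that is applied first. -/
noncomputable def act [DecidableEq ι] (c : Circuit F ι) (v : PauliRow F ι) : PauliRow F ι :=
  List.foldl (fun w L => L.act w) v c

/-- The circuit changes the stabilizer generated by `S(D)` into the one generated by `S'(D)`. -/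
def Transforms [DecidableEq ι] (c : Circuit F ι) (S S' : Stabilizer F ρ ι) : Prop :=
  Submodule.span F[T;T⁻¹] (Set.range fun i => c.act (S.row i)) = S'.rowSpace

/-- The same circuit on other qudits. -/
def map (f : ι ↪ κ) (c : Circuit F ι) : Circuit F κ := List.map (Layer.map f) c

/-- Interleaved copies of a circuit: qudits are indexed by pairs, and the `j`-th copy acts on the
qudits `(i, a j)`. -/
def strandCopies {r : ℕ} (c : Circuit F ι) (a : Fin r ↪ κ) : Circuit F (ι × κ) :=
  (List.finRange r).flatMap fun j =>
    c.map ⟨fun i => (i, a j), fun _ _ h => (Prod.ext_iff.1 h).1⟩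

/-- Blockwise copies of a circuit: qudits are indexed by pairs, and the copy for the block `b` acts
on the qudits `(b, i)`. -/
def blockCopies (n : ℕ) (c : Circuit F ι) : Circuit F (Fin n × ι) :=
  (List.finRange n).flatMap fun b =>
    c.map ⟨fun i => (b, i), fun _ _ h => (Prod.ext_iff.1 h).2⟩

end Circuit

end QConv

open QConv

/-!
The rows of a non-catastrophic stabilizer matrix generate a module `M` of Laurent polynomial rows
that is isotropic for the form `x(D) z'(1/D)ᵗ - z(D) x'(1/D)ᵗ` and has a torsion-free quotient. Say
that a row of `M` splits if it is the sum of a row of `M` without negative powers of `D` and one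
with only negative powers. The split rows have finite codimension in `M`, at most the constraint
length. If some row does not split, then isotropy provides an isometry of one of three kinds, which
involve one or two vectors of a single frame, that makes it smaller: the delay of a hyperbolic
pair, a transvection, or a Siegel transformation for two orthogonal vectors. It has a circuit of
depth linear in the number of qudits, because a Clifford circuit on one frame moves the vectors to
Pauli matrices on at most two qudits. If all rows split, `M` is generated by constant rows, and
symplectic Gaussian elimination finishes the construction.

For the product, Fourier transforms turn `(0 | I 0)` into `(I 0 | 0)`. The interleaved copies of a
circuit for `(G₁ | 0)` then produce `G₁` on the ancilla positions of `S₂`, and the copies of a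
circuit for `S₂` map the row `g ⊗ (e | 0)` of the `j`-th ancilla to `g ⊗ s`, where `s` is the `j`-th
row of `S₂`.
-/

namespace QConv

section PhaseSpace

/-- Vectors `(x | z)` over a ring `A`: the rows of stabilizer matrices if `A` consists of the
Laurent polynomials in `D`, and Pauli matrices on a single frame if `A` is the field. -/
abbrev PhaseSpace (A ι : Type*) : Type _ := (ι → A) × (ι → A)

variable {A ι : Type*} [CommRing A]

section Pauli

variable [DecidableEq ι]

/-- The vector of the Pauli matrix `X` on qudit `j`. -/
def pauliX (j : ι) : PhaseSpace A ι := (Pi.single j 1, 0)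

/-- The vector of the Pauli matrix `Z` on qudit `j`. -/
def pauliZ (j : ι) : PhaseSpace A ι := (0, Pi.single j 1)

theorem linearIndependent_pauliX_comp {ρ : Type*} (a : ρ ↪ ι) :
    LinearIndependent A fun i => (pauliX (a i) : PhaseSpace A ι) :=
  ((Pi.linearIndependent_single_one ι A).comp a a.injective).map_injOn
    (LinearMap.inl A (ι → A) (ι → A)) LinearMap.inl_injective.injOn

end Pauli

section Form

variable [Fintype ι]

/-- The form `⟨(x | z), (x' | z')⟩ = x σ(z')ᵗ - z σ(x')ᵗ`. For `σ = id` this is the symplectic form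
of the commutation relations, and for the inversion `σ : D ↦ 1 / D` it collects the symplectic
products of a row with all the shifts of another one. -/
def symplecticForm (σ : A →+* A) : PhaseSpace A ι →ₗ[A] PhaseSpace A ι →ₛₗ[σ] A :=
  LinearMap.mk₂'ₛₗ (RingHom.id A) σ (fun v w => ∑ k, (v.1 k * σ (w.2 k) - v.2 k * σ (w.1 k)))
    (fun a b c => by simp only [← Finset.sum_add_distrib]; congr! 1; simp; ring)
    (fun a b c => by simp only [smul_eq_mul, Finset.mul_sum]; congr! 1; simp; ring)
    (fun a b c => by simp only [← Finset.sum_add_distrib]; congr! 1; simp; ring)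
    (fun a b c => by simp only [smul_eq_mul, Finset.mul_sum]; congr! 1; simp; ring)

theorem symplecticForm_apply (σ : A →+* A) (v w : PhaseSpace A ι) :
    symplecticForm σ v w = ∑ k, (v.1 k * σ (w.2 k) - v.2 k * σ (w.1 k)) := rfl

theorem symplecticForm_swap {σ : A →+* A} (hσ : Function.Involutive σ) (v w : PhaseSpace A ι) :
    symplecticForm σ w v = -σ (symplecticForm σ v w) := by
  simp only [symplecticForm_apply, map_sum, ← Finset.sum_neg_distrib]
  refine Finset.sum_congr rfl fun k _ => ?_
  simp only [map_sub, map_mul, hσ _]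
  ring

variable [DecidableEq ι]

@[simp]
theorem symplecticForm_pauliX_right (σ : A →+* A) (v : PhaseSpace A ι) (j : ι) :
    symplecticForm σ v (pauliX j) = -v.2 j := by
  simp [symplecticForm_apply, pauliX, Pi.single_apply, apply_ite σ]

@[simp]
theorem symplecticForm_pauliZ_right (σ : A →+* A) (v : PhaseSpace A ι) (j : ι) :
    symplecticForm σ v (pauliZ j) = v.1 j := by
  simp [symplecticForm_apply, pauliZ, Pi.single_apply, apply_ite σ]

@[simp]
theorem symplecticForm_pauliX_left (σ : A →+* A) (v : PhaseSpace A ι) (j : ι) :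
    symplecticForm σ (pauliX j) v = σ (v.2 j) := by
  simp [symplecticForm_apply, pauliX, Pi.single_apply]

@[simp]
theorem symplecticForm_pauliZ_left (σ : A →+* A) (v : PhaseSpace A ι) (j : ι) :
    symplecticForm σ (pauliZ j) v = -σ (v.1 j) := by
  simp [symplecticForm_apply, pauliZ, Pi.single_apply]

end Form

section ElementaryMaps

variable [DecidableEq ι]

/-- The Fourier transform `(x i, z i) ↦ (z i, -x i)`. -/
def fourierEquiv (i : ι) : PhaseSpace A ι ≃ₗ[A] PhaseSpace A ι where
  toFun v := (Function.update v.1 i (v.2 i), Function.update v.2 i (-v.1 i))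
  invFun v := (Function.update v.1 i (-v.2 i), Function.update v.2 i (v.1 i))
  map_add' v w := by ext k <;> by_cases h : k = i <;> simp [h, add_comm]
  map_smul' a v := by ext k <;> by_cases h : k = i <;> simp [h]
  left_inv v := by simp
  right_inv v := by simp

/-- The scaling `(x i, z i) ↦ (γ⁻¹ x i, γ z i)`. -/
def scaleEquiv (γ : Aˣ) (i : ι) : PhaseSpace A ι ≃ₗ[A] PhaseSpace A ι where
  toFun v := (Function.update v.1 i (↑γ⁻¹ * v.1 i), Function.update v.2 i (γ * v.2 i))
  invFun v := (Function.update v.1 i (γ * v.1 i), Function.update v.2 i (↑γ⁻¹ * v.2 i))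
  map_add' v w := by ext k <;> by_cases h : k = i <;> simp [h, mul_add]
  map_smul' a v := by ext k <;> by_cases h : k = i <;> simp [h, mul_left_comm]
  left_inv v := by simp
  right_inv v := by simp

/-- The shear `z i ↦ z i + h * x i`. -/
def shearEquiv (i : ι) (h : A) : PhaseSpace A ι ≃ₗ[A] PhaseSpace A ι where
  toFun v := v + (h * v.1 i) • pauliZ i
  invFun v := v - (h * v.1 i) • pauliZ i
  map_add' v w := by rw [Prod.fst_add, Pi.add_apply]; module
  map_smul' a v := by
    rw [Prod.smul_fst, Pi.smul_apply, smul_eq_mul, RingHom.id_apply]; module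
  left_inv v := by simp [pauliZ]
  right_inv v := by simp [pauliZ]

/-- The map `x j ↦ x j + f * x i`, `z i ↦ z i - σ f * z j`. -/
def addEquiv (σ : A →+* A) (i j : ι) (hij : i ≠ j) (f : A) :
    PhaseSpace A ι ≃ₗ[A] PhaseSpace A ι where
  toFun v := v + ((f * v.1 i) • pauliX j - (σ f * v.2 j) • pauliZ i)
  invFun v := v - ((f * v.1 i) • pauliX j - (σ f * v.2 j) • pauliZ i)
  map_add' v w := by
    rw [Prod.fst_add, Prod.snd_add, Pi.add_apply, Pi.add_apply]; module
  map_smul' a v := by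
    rw [Prod.smul_fst, Prod.smul_snd, Pi.smul_apply, Pi.smul_apply, smul_eq_mul, smul_eq_mul,
      RingHom.id_apply]
    module
  left_inv v := by simp [pauliX, pauliZ, hij, hij.symm]
  right_inv v := by simp [pauliX, pauliZ, hij, hij.symm]

theorem fourierEquiv_apply (i : ι) (v : PhaseSpace A ι) : fourierEquiv i v =
    (Function.update v.1 i (v.2 i), Function.update v.2 i (-v.1 i)) := rfl

theorem scaleEquiv_apply (γ : Aˣ) (i : ι) (v : PhaseSpace A ι) : scaleEquiv γ i v =
    (Function.update v.1 i (↑γ⁻¹ * v.1 i), Function.update v.2 i (γ * v.2 i)) := rfl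

theorem shearEquiv_apply (i : ι) (h : A) (v : PhaseSpace A ι) :
    shearEquiv i h v = v + (h * v.1 i) • pauliZ i := rfl

theorem addEquiv_apply (σ : A →+* A) (i j : ι) (hij : i ≠ j) (f : A) (v : PhaseSpace A ι) :
    addEquiv σ i j hij f v = v + ((f * v.1 i) • pauliX j - (σ f * v.2 j) • pauliZ i) := rfl

theorem fourierEquiv_symm (i : ι) :
    (fourierEquiv i).symm = (scaleEquiv (-1 : Aˣ) i).trans (fourierEquiv i) := by
  ext1 v
  rw [LinearEquiv.symm_apply_eq]
  ext k <;> by_cases h : k = i <;> simp [fourierEquiv_apply, scaleEquiv_apply, h]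

theorem scaleEquiv_symm (γ : Aˣ) (i : ι) : (scaleEquiv γ i).symm = scaleEquiv γ⁻¹ i := by
  ext1 v
  rw [LinearEquiv.symm_apply_eq]
  simp [scaleEquiv_apply]

theorem shearEquiv_symm (i : ι) (h : A) : (shearEquiv i h).symm = shearEquiv i (-h) := by
  ext1 v
  rw [shearEquiv_apply, neg_mul, neg_smul, ← sub_eq_add_neg]
  rfl

theorem addEquiv_symm (σ : A →+* A) (i j : ι) (hij : i ≠ j) (f : A) :
    (addEquiv σ i j hij f).symm = addEquiv σ i j hij (-f) := by
  ext1 v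
  rw [addEquiv_apply, map_neg, neg_mul, neg_mul, neg_smul, neg_smul, neg_sub_neg,
    ← neg_sub, ← sub_eq_add_neg]
  rfl

theorem shearEquiv_zero (i : ι) : shearEquiv i (0 : A) = LinearEquiv.refl A _ := by
  ext1 v
  simp [shearEquiv_apply]

theorem addEquiv_zero (σ : A →+* A) (i j : ι) (hij : i ≠ j) :
    addEquiv σ i j hij 0 = LinearEquiv.refl A _ := by
  ext1 v
  simp [addEquiv_apply]

theorem shearEquiv_trans (i : ι) (h h' : A) :
    (shearEquiv i h).trans (shearEquiv i h') = shearEquiv i (h + h') := by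
  ext1 v
  rw [LinearEquiv.trans_apply, shearEquiv_apply, shearEquiv_apply, shearEquiv_apply]
  simp only [pauliZ, Prod.fst_add, Prod.smul_fst, smul_zero, add_zero]
  module

theorem shearEquiv_conj_scaleEquiv (γ : Aˣ) (i : ι) (h : A) :
    ((scaleEquiv γ i).symm.trans (shearEquiv i h)).trans (scaleEquiv γ i) =
      shearEquiv i (γ ^ 2 * h) := by
  ext1 v
  ext k <;> by_cases hk : k = i <;>
    simp [scaleEquiv_symm, scaleEquiv_apply, shearEquiv_apply, pauliZ, hk, mul_add, sq, mul_assoc,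
      mul_left_comm h]

variable {σ : A →+* A}

theorem addEquiv_conj_scaleEquiv {γ : Aˣ} (hγ : σ γ = γ) (i j : ι) (hij : i ≠ j) (f : A) :
    ((scaleEquiv γ i).symm.trans (addEquiv σ i j hij f)).trans (scaleEquiv γ i) =
      addEquiv σ i j hij (γ * f) := by
  ext1 v
  ext k
  · by_cases hi : k = i
    · subst hi
      simp [scaleEquiv_symm, scaleEquiv_apply, addEquiv_apply, pauliX, pauliZ, hij]
    · simp [scaleEquiv_symm, scaleEquiv_apply, addEquiv_apply, pauliX, pauliZ, hi, mul_left_comm,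
        mul_assoc]
  · by_cases hi : k = i <;>
      simp [scaleEquiv_symm, scaleEquiv_apply, addEquiv_apply, pauliX, pauliZ, hi, hij.symm, hγ,
        mul_add, mul_assoc]

variable [Fintype ι]

theorem symplecticForm_fourierEquiv (σ : A →+* A) (i : ι) (v w : PhaseSpace A ι) :
    symplecticForm σ (fourierEquiv i v) (fourierEquiv i w) = symplecticForm σ v w := by
  refine Finset.sum_congr rfl fun k _ => ?_
  by_cases h : k = i
  · subst h
    simp only [fourierEquiv_apply, Function.update_self, map_neg]
    ring
  · simp only [fourierEquiv_apply, Function.update_of_ne h]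

theorem symplecticForm_scaleEquiv {γ : Aˣ} (hγ : σ γ = γ) (i : ι) (v w : PhaseSpace A ι) :
    symplecticForm σ (scaleEquiv γ i v) (scaleEquiv γ i w) = symplecticForm σ v w := by
  have hγ' : σ ↑γ⁻¹ = ↑γ⁻¹ := (Units.inv_eq_of_mul_eq_one_right (by
    rw [← hγ, ← map_mul, γ.mul_inv, map_one])).symm
  refine Finset.sum_congr rfl fun k _ => ?_
  by_cases h : k = i
  · subst h
    simp only [scaleEquiv_apply, Function.update_self, map_mul, hγ, hγ']
    linear_combination (v.1 k * σ (w.2 k) - v.2 k * σ (w.1 k)) * γ.inv_mul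
  · simp only [scaleEquiv_apply, Function.update_of_ne h]

theorem symplecticForm_shearEquiv {h : A} (hh : σ h = h) (i : ι) (v w : PhaseSpace A ι) :
    symplecticForm σ (shearEquiv i h v) (shearEquiv i h w) = symplecticForm σ v w := by
  simp only [shearEquiv_apply, map_add, map_smul, map_smulₛₗ, LinearMap.add_apply,
    LinearMap.smul_apply, symplecticForm_pauliZ_left, symplecticForm_pauliZ_right, smul_eq_mul,
    map_mul, hh]
  simp only [pauliZ, Pi.zero_apply]
  ring

theorem symplecticForm_addEquiv (hσ : Function.Involutive σ) (i j : ι) (hij : i ≠ j) (f : A)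
    (v w : PhaseSpace A ι) : symplecticForm σ (addEquiv σ i j hij f v) (addEquiv σ i j hij f w) =
      symplecticForm σ v w := by
  simp only [addEquiv_apply, map_add, map_sub, map_smul, map_smulₛₗ, LinearMap.add_apply,
    LinearMap.sub_apply, LinearMap.smul_apply, symplecticForm_pauliX_left,
    symplecticForm_pauliX_right, symplecticForm_pauliZ_left, symplecticForm_pauliZ_right,
    smul_eq_mul, map_mul, hσ f]
  simp only [pauliX, pauliZ, Pi.zero_apply, Pi.single_eq_of_ne hij, Pi.single_eq_of_ne hij.symm]
  ring

end ElementaryMaps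

end PhaseSpace

section Coefficients

variable {F ι : Type*} [Field F]

theorem coeff_T_mul (n k : ℤ) (f : F[T;T⁻¹]) : (T n * f).coeff k = f.coeff (k - n) := by
  simp [T, -single_eq_C_mul_T, -T_mul, AddMonoidAlgebra.coeff_single_mul_apply, neg_add_eq_sub]

theorem coeff_mul_C (a : F) (k : ℤ) (f : F[T;T⁻¹]) :
    (f * LaurentPolynomial.C a).coeff k = f.coeff k * a := by
  rw [mul_comm, ← LaurentPolynomial.smul_eq_C_mul, mul_comm]
  rfl

theorem coeff_mul_eq_zero {f g : F[T;T⁻¹]} (hf : ∀ k, 0 < k → f.coeff k = 0)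
    (hg : ∀ k, 0 < k → g.coeff k = 0) {k : ℤ} (hk : 0 < k) : (f * g).coeff k = 0 := by
  rw [AddMonoidAlgebra.coeff_mul]
  refine Finset.sum_eq_zero fun a _ => Finset.sum_eq_zero fun b _ => ?_
  dsimp only
  split_ifs with hab
  · rcases lt_or_ge 0 a with ha | ha
    · rw [hf a ha, zero_mul]
    · rw [hg b (by lia), mul_zero]
  · rfl

/-- The coefficient of `D ^ k` of a row: the Pauli matrix on frame `k`. -/
noncomputable def coeffAt (k : ℤ) : PauliRow F ι →ₗ[F] PhaseSpace F ι where
  toFun v := (fun i => (v.1 i).coeff k, fun i => (v.2 i).coeff k)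
  map_add' v w := by ext <;> simp
  map_smul' a v := by ext <;> simp

/-- The row with a Pauli matrix on frame `0` and the identity on all others. -/
noncomputable def constRow : PhaseSpace F ι →ₗ[F] PauliRow F ι where
  toFun u := (fun i => LaurentPolynomial.C (u.1 i), fun i => LaurentPolynomial.C (u.2 i))
  map_add' u v := by ext1 <;> ext1 i <;> simp
  map_smul' a u := by ext1 <;> ext1 i <;> simp [LaurentPolynomial.smul_eq_C_mul]

theorem ext_coeffAt {x y : PauliRow F ι} (h : ∀ k, coeffAt k x = coeffAt k y) : x = y := by
  ext i k
  · exact congrFun (congrArg Prod.fst (h k)) i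
  · exact congrFun (congrArg Prod.snd (h k)) i

theorem coeffAt_T_smul (n k : ℤ) (x : PauliRow F ι) :
    coeffAt k ((T n : F[T;T⁻¹]) • x) = coeffAt (k - n) x := by
  ext i <;> exact coeff_T_mul n k _

theorem coeffAt_smul_constRow (k : ℤ) (f : F[T;T⁻¹]) (u : PhaseSpace F ι) :
    coeffAt k (f • constRow u) = f.coeff k • u := by
  ext i <;> exact coeff_mul_C _ k f

theorem coeffAt_constRow (k : ℤ) (u : PhaseSpace F ι) :
    coeffAt k (constRow u) = if k = 0 then u else 0 := by
  rw [← one_smul F[T;T⁻¹] (constRow u), coeffAt_smul_constRow, ← map_one LaurentPolynomial.C,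
    C_apply]
  split_ifs <;> simp

theorem constRow_smul (a : F) (u : PhaseSpace F ι) :
    constRow (a • u) = LaurentPolynomial.C a • constRow u := by
  ext1 <;> ext1 i <;> exact map_mul LaurentPolynomial.C a _

variable [DecidableEq ι]

@[simp]
theorem constRow_pauliX (j : ι) : constRow (pauliX j : PhaseSpace F ι) = pauliX j := by
  ext1 <;> ext1 i <;> simp [constRow, pauliX, Pi.single_apply, apply_ite LaurentPolynomial.C]

@[simp]
theorem constRow_pauliZ (j : ι) : constRow (pauliZ j : PhaseSpace F ι) = pauliZ j := by
  ext1 <;> ext1 i <;> simp [constRow, pauliZ, Pi.single_apply, apply_ite LaurentPolynomial.C]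

theorem fourierEquiv_constRow (i : ι) (u : PhaseSpace F ι) :
    fourierEquiv i (constRow u) = constRow (fourierEquiv i u) := by
  ext1 <;> ext1 k <;> by_cases h : k = i <;> simp [fourierEquiv_apply, constRow, h]

theorem scaleEquiv_constRow (γ : Fˣ) (i : ι) (u : PhaseSpace F ι) :
    scaleEquiv (γ.map (LaurentPolynomial.C (R := F)).toMonoidHom) i (constRow u) =
      constRow (scaleEquiv γ i u) := by
  ext1 <;> ext1 k <;> by_cases h : k = i <;> simp [scaleEquiv_apply, constRow, h]

theorem shearEquiv_constRow (i : ι) (h : F) (u : PhaseSpace F ι) :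
    shearEquiv i (LaurentPolynomial.C h) (constRow u) = constRow (shearEquiv i h u) := by
  rw [shearEquiv_apply, shearEquiv_apply, map_add, constRow_smul, constRow_pauliZ, map_mul]
  rfl

end Coefficients

section RowForm

variable {F ι : Type*} [Field F]

/-- The inversion `D ↦ 1 / D`. -/
noncomputable abbrev invertHom (F : Type*) [Field F] : F[T;T⁻¹] →+* F[T;T⁻¹] :=
  RingHomClass.toRingHom (invert : F[T;T⁻¹] ≃ₐ[F] F[T;T⁻¹])

theorem involutive_invertHom : Function.Involutive (invertHom F) := involutive_invert

/-- The skew-Hermitian form `x(D) z'(1/D)ᵗ - z(D) x'(1/D)ᵗ` on rows. -/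
noncomputable abbrev rowForm [Fintype ι] :
    PauliRow F ι →ₗ[F[T;T⁻¹]] PauliRow F ι →ₛₗ[invertHom F] F[T;T⁻¹] :=
  symplecticForm (invertHom F)

/-- The symplectic form on a single frame. -/
abbrev sympl [Fintype ι] : LinearMap.BilinForm F (PhaseSpace F ι) := symplecticForm (RingHom.id F)

theorem addEquiv_constRow [DecidableEq ι] (i j : ι) (hij : i ≠ j) (f : F) (u : PhaseSpace F ι) :
    addEquiv (invertHom F) i j hij (LaurentPolynomial.C f) (constRow u) =
      constRow (addEquiv (RingHom.id F) i j hij f u) := by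
  have hf : invertHom F (LaurentPolynomial.C f) = LaurentPolynomial.C f := invert_C f
  rw [addEquiv_apply, addEquiv_apply, hf, map_add, map_sub, constRow_smul, constRow_smul,
    constRow_pauliX, constRow_pauliZ, map_mul, map_mul]
  rfl

variable [Fintype ι]

theorem sympl_swap (v w : PhaseSpace F ι) : sympl w v = -sympl v w :=
  symplecticForm_swap (σ := RingHom.id F) (fun _ => rfl) v w

theorem sympl_self (v : PhaseSpace F ι) : sympl v v = 0 := by
  rw [symplecticForm_apply]
  exact Finset.sum_eq_zero fun k _ => by rw [RingHom.id_apply, RingHom.id_apply]; ring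

theorem sympl_isRefl : (sympl (F := F) (ι := ι)).IsRefl := fun v w h => by
  rw [sympl_swap, h, neg_zero]

theorem sympl_nondegenerate : (sympl (F := F) (ι := ι)).Nondegenerate := by
  classical
  have separating (v : PhaseSpace F ι) (hv : ∀ w, sympl v w = 0) : v = 0 := by
    ext i
    · simpa using hv (pauliZ i)
    · simpa using hv (pauliX i)
  exact ⟨separating, fun v hv => separating v fun w => by rw [sympl_swap, hv w, neg_zero]⟩

theorem coeff_rowForm_constRow (x : PauliRow F ι) (u : PhaseSpace F ι) (k : ℤ) :
    (rowForm x (constRow u)).coeff k = sympl (coeffAt k x) u := by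
  simp only [symplecticForm_apply, constRow, coeffAt]
  simp [AddMonoidAlgebra.coeff_sum, coeff_mul_C]

theorem rowForm_constRow (u v : PhaseSpace F ι) :
    rowForm (constRow u) (constRow v) = LaurentPolynomial.C (sympl u v) := by
  ext k
  rw [coeff_rowForm_constRow, coeffAt_constRow, C_apply]
  split_ifs
  · rfl
  · rw [map_zero, LinearMap.zero_apply]

theorem coeff_rowForm_eq_zero {x y : PauliRow F ι} (hx : ∀ k, 0 < k → coeffAt k x = 0)
    (hy : ∀ k, k < 0 → coeffAt k y = 0) {k : ℤ} (hk : 0 < k) : (rowForm x y).coeff k = 0 := by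
  have x_eq (i k) (h : 0 < k) : (x.1 i).coeff k = 0 ∧ (x.2 i).coeff k = 0 :=
    ⟨congrFun (congrArg Prod.fst (hx k h)) i, congrFun (congrArg Prod.snd (hx k h)) i⟩
  have y_eq (i k) (h : 0 < k) :
      (invert (y.1 i)).coeff k = 0 ∧ (invert (y.2 i)).coeff k = 0 := by
    rw [invert_apply, invert_apply]
    exact ⟨congrFun (congrArg Prod.fst (hy (-k) (by lia))) i,
      congrFun (congrArg Prod.snd (hy (-k) (by lia))) i⟩
  simp only [symplecticForm_apply, AddMonoidAlgebra.coeff_sum, Finsupp.coe_finsetSum,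
    Finset.sum_apply]
  refine Finset.sum_eq_zero fun i _ => ?_
  have h₁ := coeff_mul_eq_zero (fun k h => (x_eq i k h).1) (fun k h => (y_eq i k h).2) hk
  have h₂ := coeff_mul_eq_zero (fun k h => (x_eq i k h).2) (fun k h => (y_eq i k h).1) hk
  exact (congrArg₂ (· - ·) h₁ h₂).trans (sub_zero 0)

end RowForm

section CircuitEquiv

variable {F ι : Type*} [Field F] [DecidableEq ι]

/-- The action of a gate as a linear automorphism. -/
noncomputable def Gate.equiv : Gate F ι → PauliRow F ι ≃ₗ[F[T;T⁻¹]] PauliRow F ι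
  | dft i => fourierEquiv i
  | mul γ i => scaleEquiv (γ.map (LaurentPolynomial.C (R := F)).toMonoidHom) i
  | phase γ i => shearEquiv i (LaurentPolynomial.C γ)
  | add i j hij l => addEquiv (invertHom F) i j hij (T l)
  | cphase i l _ => shearEquiv i (T l + T (-l))

theorem Gate.equiv_apply (g : Gate F ι) (v : PauliRow F ι) : g.equiv v = g.act v := by
  cases g with
  | dft i => rfl
  | mul γ i => rfl
  | phase γ i =>
    ext1 <;> ext1 k <;> by_cases h : k = i <;> simp [equiv, act, shearEquiv_apply, pauliZ, h]
  | add i j hij l =>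
    ext1 <;> ext1 k
    · by_cases h : k = j <;> simp [equiv, act, addEquiv_apply, pauliX, pauliZ, h]
    · by_cases h : k = i <;>
        simp [equiv, act, addEquiv_apply, pauliX, pauliZ, h, sub_eq_add_neg]
  | cphase i l hl =>
    ext1 <;> ext1 k <;> by_cases h : k = i <;> simp [equiv, act, shearEquiv_apply, pauliZ, h]

/-- The action of a layer as a linear automorphism. -/
noncomputable def Layer.equiv (L : Layer F ι) : PauliRow F ι ≃ₗ[F[T;T⁻¹]] PauliRow F ι :=
  L.gates.foldr (fun g e => g.equiv.trans e) (LinearEquiv.refl _ _)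

theorem Layer.equiv_apply (L : Layer F ι) (v : PauliRow F ι) : L.equiv v = L.act v := by
  unfold Layer.equiv Layer.act
  induction L.gates generalizing v with
  | nil => rfl
  | cons g l ih => rw [List.foldr_cons, List.foldl_cons, LinearEquiv.trans_apply, ih,
      Gate.equiv_apply]

namespace Circuit

/-- The action of a circuit as a linear automorphism. -/
noncomputable def equiv (c : Circuit F ι) : PauliRow F ι ≃ₗ[F[T;T⁻¹]] PauliRow F ι :=
  List.foldr (fun L e => L.equiv.trans e) (LinearEquiv.refl _ _) c

theorem equiv_apply (c : Circuit F ι) (v : PauliRow F ι) : c.equiv v = c.act v := by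
  unfold equiv act
  induction c generalizing v with
  | nil => rfl
  | cons L c ih => rw [List.foldr_cons, List.foldl_cons, LinearEquiv.trans_apply, ih,
      Layer.equiv_apply]

theorem act_append (c c' : Circuit F ι) (v : PauliRow F ι) :
    act (c ++ c') v = act c' (act c v) :=
  List.foldl_append

theorem equiv_append (c c' : Circuit F ι) : equiv (c ++ c') = (equiv c).trans (equiv c') := by
  ext1 v
  rw [LinearEquiv.trans_apply, equiv_apply, equiv_apply, equiv_apply, act_append]

omit [DecidableEq ι] in
theorem depth_append (c c' : Circuit F ι) : depth (c ++ c') = depth c + depth c' := by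
  rw [depth, List.map_append, List.sum_append]
  rfl

theorem transforms_iff {ρ : Type*} (c : Circuit F ι) (S S' : Stabilizer F ρ ι) :
    c.Transforms S S' ↔ S.rowSpace.map c.equiv.toLinearMap = S'.rowSpace := by
  rw [Transforms, Stabilizer.rowSpace.eq_1 S, Submodule.map_span, ← Set.range_comp]
  simp only [Function.comp_def, LinearEquiv.coe_coe, equiv_apply]

/-- The circuit that consists of a single gate. -/
def ofGate (g : Gate F ι) : Circuit F ι := [⟨[g], List.pairwise_singleton _ _⟩]

omit [DecidableEq ι] in
theorem depth_ofGate (g : Gate F ι) : (ofGate g).depth = g.duration := by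
  simp [ofGate, depth, Layer.duration]

end Circuit

section Isometry

variable [Fintype ι]

theorem Gate.rowForm_equiv (g : Gate F ι) (v w : PauliRow F ι) :
    rowForm (g.equiv v) (g.equiv w) = rowForm v w := by
  cases g with
  | dft i => exact symplecticForm_fourierEquiv _ i v w
  | mul γ i => exact symplecticForm_scaleEquiv (invert_C (γ : F)) i v w
  | phase γ i => exact symplecticForm_shearEquiv (invert_C γ) i v w
  | add i j hij l => exact symplecticForm_addEquiv involutive_invertHom i j hij _ v w
  | cphase i l hl =>
    exact symplecticForm_shearEquiv (by simp [add_comm]) i v w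

theorem Layer.rowForm_equiv (L : Layer F ι) (v w : PauliRow F ι) :
    rowForm (L.equiv v) (L.equiv w) = rowForm v w := by
  unfold Layer.equiv
  induction L.gates generalizing v w with
  | nil => rfl
  | cons g l ih => exact (ih _ _).trans (g.rowForm_equiv v w)

theorem Circuit.rowForm_equiv (c : Circuit F ι) (v w : PauliRow F ι) :
    rowForm (c.equiv v) (c.equiv w) = rowForm v w := by
  unfold Circuit.equiv
  induction c generalizing v w with
  | nil => rfl
  | cons L c ih => exact (ih _ _).trans (L.rowForm_equiv v w)

end Isometry

end CircuitEquiv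

section Delay

variable {F ι : Type*} [Field F]

theorem T_mul_T_neg_mul (k : ℤ) (f : F[T;T⁻¹]) : T k * (T (-k) * f) = f := by
  rw [← mul_assoc, ← T_add, add_neg_cancel, T_zero, one_mul]

/-- The delay of every qudit `i` by `t i` frames. -/
noncomputable def delayEquiv (t : ι → ℤ) : PauliRow F ι ≃ₗ[F[T;T⁻¹]] PauliRow F ι where
  toFun v := (fun i => T (t i) * v.1 i, fun i => T (t i) * v.2 i)
  invFun v := (fun i => T (-t i) * v.1 i, fun i => T (-t i) * v.2 i)
  map_add' v w := by ext1 <;> ext1 i <;> exact mul_add _ _ _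
  map_smul' f v := by ext1 <;> ext1 i <;> exact mul_left_comm _ _ _
  left_inv v := by
    ext1 <;> ext1 i <;> simpa only [neg_neg] using T_mul_T_neg_mul (-t i) _
  right_inv v := by ext1 <;> ext1 i <;> exact T_mul_T_neg_mul (t i) _

theorem delayEquiv_apply (t : ι → ℤ) (v : PauliRow F ι) :
    delayEquiv t v = (fun i => T (t i) * v.1 i, fun i => T (t i) * v.2 i) := rfl

@[simp]
theorem delayEquiv_fst (t : ι → ℤ) (v : PauliRow F ι) (i : ι) :
    (delayEquiv t v).1 i = T (t i) * v.1 i := rfl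

@[simp]
theorem delayEquiv_snd (t : ι → ℤ) (v : PauliRow F ι) (i : ι) :
    (delayEquiv t v).2 i = T (t i) * v.2 i := rfl

theorem delayEquiv_symm (t : ι → ℤ) : (delayEquiv (F := F) t).symm = delayEquiv (-t) :=
  LinearEquiv.ext fun _ => rfl

theorem delayEquiv_trans (s t : ι → ℤ) :
    (delayEquiv (F := F) s).trans (delayEquiv t) = delayEquiv (s + t) := by
  ext1 v
  ext1 <;> ext1 i <;>
    simp only [LinearEquiv.trans_apply, delayEquiv_apply, Pi.add_apply, T_add] <;> ring

theorem delayEquiv_zero :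
    delayEquiv (F := F) (0 : ι → ℤ) = LinearEquiv.refl F[T;T⁻¹] (PauliRow F ι) := by
  ext1 v
  ext1 <;> ext1 i <;> simp [delayEquiv_apply]

theorem rowForm_delayEquiv [Fintype ι] (t : ι → ℤ) (v w : PauliRow F ι) :
    rowForm (delayEquiv t v) (delayEquiv t w) = rowForm v w := by
  refine Finset.sum_congr rfl fun i _ => ?_
  have hT : T (t i) * invertHom F (T (t i)) = 1 := by
    rw [RingHom.coe_coe, invert_T, ← T_add, add_neg_cancel, T_zero]
  simp only [delayEquiv_apply, map_mul]
  linear_combination (v.1 i * invertHom F (w.2 i) - v.2 i * invertHom F (w.1 i)) * hT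

/-- The gate conjugated by a delay. -/
def Gate.delayed (t : ι → ℤ) : Gate F ι → Gate F ι
  | add i j hij l => add i j hij (l + t j - t i)
  | g => g

theorem Gate.wires_delayed (t : ι → ℤ) (g : Gate F ι) : (g.delayed t).wires = g.wires := by
  cases g <;> rfl

theorem Gate.duration_delayed (t : ι → ℤ) (g : Gate F ι) :
    (g.delayed t).duration = g.duration := by
  cases g <;> rfl

/-- The layer conjugated by a delay. -/
def Layer.delayed (t : ι → ℤ) (L : Layer F ι) : Layer F ι where
  gates := L.gates.map (Gate.delayed t)
  disjoint := L.disjoint.map _ fun g h hgh => by rwa [Gate.wires_delayed, Gate.wires_delayed]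

theorem Layer.duration_delayed (t : ι → ℤ) (L : Layer F ι) :
    (L.delayed t).duration = L.duration := by
  simp [Layer.duration, Layer.delayed, Function.comp_def, Gate.duration_delayed]

/-- The circuit conjugated by a delay. -/
def Circuit.delayed (t : ι → ℤ) (c : Circuit F ι) : Circuit F ι := List.map (Layer.delayed t) c

theorem Circuit.depth_delayed (t : ι → ℤ) (c : Circuit F ι) :
    (c.delayed t).depth = c.depth := by
  simp [Circuit.depth, Circuit.delayed, Function.comp_def, Layer.duration_delayed]

variable [DecidableEq ι]

theorem delayEquiv_pauliX (t : ι → ℤ) (j : ι) :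
    delayEquiv t (pauliX j : PauliRow F ι) = (T (t j) : F[T;T⁻¹]) • pauliX j := by
  ext1 <;> ext1 i <;> by_cases h : i = j <;> simp [delayEquiv_apply, pauliX, h]

theorem delayEquiv_pauliZ (t : ι → ℤ) (j : ι) :
    delayEquiv t (pauliZ j : PauliRow F ι) = (T (t j) : F[T;T⁻¹]) • pauliZ j := by
  ext1 <;> ext1 i <;> by_cases h : i = j <;> simp [delayEquiv_apply, pauliZ, h]

theorem delayEquiv_shearEquiv (t : ι → ℤ) (i : ι) (h : F[T;T⁻¹]) (v : PauliRow F ι) :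
    delayEquiv t (shearEquiv i h v) = shearEquiv i h (delayEquiv t v) := by
  simp only [shearEquiv_apply, map_add, map_smul, delayEquiv_pauliZ, smul_smul]
  rw [delayEquiv_fst, mul_assoc, mul_comm (v.1 i)]

theorem Gate.equiv_delayed (t : ι → ℤ) (g : Gate F ι) (v : PauliRow F ι) :
    (g.delayed t).equiv (delayEquiv t v) = delayEquiv t (g.equiv v) := by
  cases g with
  | dft i =>
    ext1 <;> ext1 k <;> by_cases h : k = i <;>
      simp [delayed, equiv, fourierEquiv_apply, delayEquiv_apply, h, -T_mul]
  | mul γ i =>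
    ext1 <;> ext1 k <;> by_cases h : k = i <;>
      simp [delayed, equiv, scaleEquiv_apply, delayEquiv_apply, h, -T_mul, mul_left_comm]
  | phase γ i => exact (delayEquiv_shearEquiv t i _ v).symm
  | cphase i l hl => exact (delayEquiv_shearEquiv t i _ v).symm
  | add i j hij l =>
    have hX : (T (l + t j - t i) : F[T;T⁻¹]) * T (t i) = T l * T (t j) := by
      rw [← T_add, ← T_add]; congr 1; ring
    have hZ : (T (-(l + t j - t i)) : F[T;T⁻¹]) * T (t j) = T (-l) * T (t i) := by
      rw [← T_add, ← T_add]; congr 1; ring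
    simp only [delayed, equiv, addEquiv_apply, map_add, map_sub, map_smul, delayEquiv_pauliX,
      delayEquiv_pauliZ, smul_smul, RingHom.coe_coe, invert_T, delayEquiv_fst,
      delayEquiv_snd]
    rw [← mul_assoc, hX, ← mul_assoc, hZ, mul_right_comm, mul_right_comm (T (-l))]

theorem Layer.equiv_delayed (t : ι → ℤ) (L : Layer F ι) (v : PauliRow F ι) :
    (L.delayed t).equiv (delayEquiv t v) = delayEquiv t (L.equiv v) := by
  simp only [Layer.equiv, Layer.delayed]
  induction L.gates generalizing v with
  | nil => rfl
  | cons g l ih => simp only [List.map_cons, List.foldr_cons, LinearEquiv.trans_apply,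
      Gate.equiv_delayed, ih]

theorem Circuit.equiv_delayed (t : ι → ℤ) (c : Circuit F ι) (v : PauliRow F ι) :
    (c.delayed t).equiv (delayEquiv t v) = delayEquiv t (c.equiv v) := by
  simp only [Circuit.equiv, Circuit.delayed]
  induction c generalizing v with
  | nil => rfl
  | cons L c ih => simp only [List.map_cons, List.foldr_cons, LinearEquiv.trans_apply,
      Layer.equiv_delayed, ih]

end Delay

section Implementable

variable {F ι : Type*} [Field F] [DecidableEq ι] {k k' : ℕ}
  {φ ψ : PauliRow F ι ≃ₗ[F[T;T⁻¹]] PauliRow F ι}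

/-- The automorphism is the action of a circuit of depth at most `k` that is preceded by delays.
Delays are not gates, but they preserve the stabilizers of ancillae. -/
def Realizable (k : ℕ) (φ : PauliRow F ι ≃ₗ[F[T;T⁻¹]] PauliRow F ι) : Prop :=
  ∃ (t : ι → ℤ) (c : Circuit F ι), c.depth ≤ k ∧ (delayEquiv t).trans c.equiv = φ

namespace Realizable

theorem mono (hφ : Realizable k φ) (hk : k ≤ k') : Realizable k' φ :=
  let ⟨t, c, hc, h⟩ := hφ
  ⟨t, c, hc.trans hk, h⟩

theorem trans (hφ : Realizable k φ) (hψ : Realizable k' ψ) :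
    Realizable (k + k') (φ.trans ψ) := by
  obtain ⟨s, c, hc, rfl⟩ := hφ
  obtain ⟨t, d, hd, rfl⟩ := hψ
  refine ⟨s + t, c.delayed t ++ d, ?_, ?_⟩
  · rw [Circuit.depth_append, Circuit.depth_delayed]
    exact add_le_add hc hd
  · rw [Circuit.equiv_append, ← delayEquiv_trans]
    ext1 v
    simp only [LinearEquiv.trans_apply, Circuit.equiv_delayed]

theorem delay (t : ι → ℤ) : Realizable (F := F) 0 (delayEquiv t) := ⟨t, [], le_rfl, rfl⟩

theorem gate (g : Gate F ι) : Realizable g.duration g.equiv :=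
  ⟨0, .ofGate g, (Circuit.depth_ofGate g).le, by rw [delayEquiv_zero]; rfl⟩

theorem rowForm_apply [Fintype ι] (hφ : Realizable k φ) (v w : PauliRow F ι) :
    rowForm (φ v) (φ w) = rowForm v w := by
  obtain ⟨t, c, -, rfl⟩ := hφ
  exact (c.rowForm_equiv _ _).trans (rowForm_delayEquiv t v w)

end Realizable

/-- Both the automorphism and its inverse are realizable at cost `k`. -/
def Implementable (k : ℕ) (φ : PauliRow F ι ≃ₗ[F[T;T⁻¹]] PauliRow F ι) : Prop :=
  Realizable k φ ∧ Realizable k φ.symm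

namespace Implementable

theorem symm (hφ : Implementable k φ) : Implementable k φ.symm := ⟨hφ.2, hφ.1⟩

theorem mono (hφ : Implementable k φ) (hk : k ≤ k') : Implementable k' φ :=
  ⟨hφ.1.mono hk, hφ.2.mono hk⟩

theorem trans (hφ : Implementable k φ) (hψ : Implementable k' ψ) :
    Implementable (k + k') (φ.trans ψ) :=
  ⟨hφ.1.trans hψ.1, add_comm k' k ▸ hψ.2.trans hφ.2⟩

theorem delay (t : ι → ℤ) : Implementable (F := F) 0 (delayEquiv t) :=
  ⟨.delay t, delayEquiv_symm (F := F) t ▸ .delay (-t)⟩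

theorem refl (k : ℕ) : Implementable k (LinearEquiv.refl F[T;T⁻¹] (PauliRow F ι)) :=
  (delayEquiv_zero (F := F) (ι := ι) ▸ delay 0).mono k.zero_le

theorem conj (hψ : Implementable k ψ) (hφ : Implementable k' φ) :
    Implementable (2 * k + k') ((ψ.symm.trans φ).trans ψ) :=
  ((hψ.symm.trans hφ).trans hψ).mono (by lia)

theorem rowForm_apply [Fintype ι] (hφ : Implementable k φ) (v w : PauliRow F ι) :
    rowForm (φ v) (φ w) = rowForm v w :=
  hφ.1.rowForm_apply v w

theorem fourier (i : ι) : Implementable (F := F) 2 (fourierEquiv i) := by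
  refine ⟨(Realizable.gate (.dft i)).mono one_le_two, ?_⟩
  have h := (Realizable.gate (F := F) (.mul (-1) i)).trans (Realizable.gate (.dft i))
  have e : (-1 : Fˣ).map (LaurentPolynomial.C (R := F)).toMonoidHom = -1 :=
    Units.ext (by simp)
  rwa [Gate.equiv, Gate.equiv, e, ← fourierEquiv_symm] at h

theorem scale (γ : Fˣ) (i : ι) :
    Implementable 1 (scaleEquiv (γ.map (LaurentPolynomial.C (R := F)).toMonoidHom) i) := by
  refine ⟨.gate (.mul γ i), ?_⟩
  rw [scaleEquiv_symm, ← map_inv]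
  exact .gate (.mul γ⁻¹ i)

theorem shear_C (i : ι) (γ : F) : Implementable 1 (shearEquiv i (LaurentPolynomial.C γ)) := by
  refine ⟨.gate (.phase γ i), ?_⟩
  rw [shearEquiv_symm, ← map_neg]
  exact .gate (.phase (-γ) i)

end Implementable

end Implementable

section MonomialGates

variable {F ι : Type*} [Field F] [DecidableEq ι]

theorem Realizable.shear_sq (i : ι) {l : ℤ} (hl : l ≠ 0) (α : F) :
    Realizable 4 (shearEquiv i (LaurentPolynomial.C (α ^ 2) * (T l + T (-l)))) := by
  rcases eq_or_ne α 0 with rfl | hα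
  · rw [zero_pow two_ne_zero, map_zero, zero_mul, shearEquiv_zero]
    exact (Implementable.refl 4).1
  · have hscale := Implementable.scale (Units.mk0 α hα) i
    have h := (hscale.2.trans (.gate (.cphase i l hl))).trans hscale.1
    rwa [Gate.equiv, shearEquiv_conj_scaleEquiv, RingHom.toMonoidHom_eq_coe, Units.coe_map,
      Units.val_mk0, MonoidHom.coe_coe, ← map_pow] at h

theorem Realizable.add (i j : ι) (hij : i ≠ j) (γ : F) (l : ℤ) :
    Realizable 3 (addEquiv (invertHom F) i j hij (LaurentPolynomial.C γ * T l)) := by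
  rcases eq_or_ne γ 0 with rfl | hγ
  · rw [map_zero, zero_mul, addEquiv_zero]
    exact (Implementable.refl 3).1
  · have hscale := Implementable.scale (Units.mk0 γ hγ) i
    have h := (hscale.2.trans (.gate (.add i j hij l))).trans hscale.1
    rwa [Gate.equiv, addEquiv_conj_scaleEquiv (invert_C γ), RingHom.toMonoidHom_eq_coe,
      Units.coe_map, Units.val_mk0, MonoidHom.coe_coe] at h

theorem Implementable.add (i j : ι) (hij : i ≠ j) (γ : F) (l : ℤ) :
    Implementable 3 (addEquiv (invertHom F) i j hij (LaurentPolynomial.C γ * T l)) := by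
  refine ⟨.add i j hij γ l, ?_⟩
  rw [addEquiv_symm, ← neg_mul, ← map_neg]
  exact .add i j hij (-γ) l

theorem exists_sq_add_sq_eq [Finite F] (γ : F) : ∃ α β : F, α ^ 2 + β ^ 2 = γ := by
  have := Fintype.ofFinite F
  by_cases hF : ringChar F = 2
  · obtain ⟨α, rfl⟩ := FiniteField.isSquare_of_char_two hF γ
    exact ⟨α, 0, by ring⟩
  · obtain ⟨α, β, h⟩ := FiniteField.exists_root_sum_quadratic (R := F) (f := Polynomial.X ^ 2)
      (g := Polynomial.X ^ 2 - Polynomial.C γ) (Polynomial.degree_X_pow 2)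
      (Polynomial.degree_X_pow_sub_C two_pos γ) (FiniteField.odd_card_of_char_ne_two hF)
    rw [eval_X_pow, eval_sub, eval_X_pow, eval_C] at h
    exact ⟨α, β, by linear_combination h⟩

-- Conjugation by multiplication gates scales a controlled phase gate by squares only, and over a
-- finite field every element is a sum of two squares.
theorem Realizable.shear [Finite F] (i : ι) {l : ℤ} (hl : l ≠ 0) (γ : F) :
    Realizable 8 (shearEquiv i (LaurentPolynomial.C γ * (T l + T (-l)))) := by
  obtain ⟨α, β, rfl⟩ := exists_sq_add_sq_eq γ
  rw [map_add, add_mul, ← shearEquiv_trans]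
  exact (shear_sq i hl α).trans (shear_sq i hl β)

theorem Implementable.shear [Finite F] (i : ι) {l : ℤ} (hl : l ≠ 0) (γ : F) :
    Implementable 8 (shearEquiv i (LaurentPolynomial.C γ * (T l + T (-l)))) := by
  refine ⟨.shear i hl γ, ?_⟩
  rw [shearEquiv_symm, ← neg_mul, ← map_neg]
  exact .shear i hl (-γ)

end MonomialGates

section Clifford

variable {F ι : Type*} [Field F] [DecidableEq ι] {W W' : Finset ι} {k k' : ℕ}
  {σ τ : PhaseSpace F ι ≃ₗ[F] PhaseSpace F ι}

/-- Clifford operations on a single frame: they are implementable at cost `k`, when applied to all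
frames, and they act on the qudits in `W` only. -/
structure IsClifford (W : Finset ι) (k : ℕ) (σ : PhaseSpace F ι ≃ₗ[F] PhaseSpace F ι) : Prop where
  exists_implementable : ∃ φ, Implementable k φ ∧ ∀ u, φ (constRow u) = constRow (σ u)
  map_pauliX : ∀ m ∉ W, σ (pauliX m) = pauliX m
  map_pauliZ : ∀ m ∉ W, σ (pauliZ m) = pauliZ m

namespace IsClifford

theorem mono (hσ : IsClifford W k σ) (hW : W ⊆ W') (hk : k ≤ k') : IsClifford W' k' σ :=
  ⟨hσ.exists_implementable.imp fun _ h => ⟨h.1.mono hk, h.2⟩,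
    fun m hm => hσ.map_pauliX m (mt (@hW m) hm), fun m hm => hσ.map_pauliZ m (mt (@hW m) hm)⟩

theorem trans (hσ : IsClifford W k σ) (hτ : IsClifford W k' τ) :
    IsClifford W (k + k') (σ.trans τ) where
  exists_implementable := by
    obtain ⟨φ, hφ, hφσ⟩ := hσ.exists_implementable
    obtain ⟨ψ, hψ, hψτ⟩ := hτ.exists_implementable
    exact ⟨φ.trans ψ, hφ.trans hψ, fun u => by simp only [LinearEquiv.trans_apply, hφσ, hψτ]⟩
  map_pauliX m hm := by rw [LinearEquiv.trans_apply, hσ.map_pauliX m hm, hτ.map_pauliX m hm]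
  map_pauliZ m hm := by rw [LinearEquiv.trans_apply, hσ.map_pauliZ m hm, hτ.map_pauliZ m hm]

theorem symm (hσ : IsClifford W k σ) : IsClifford W k σ.symm where
  exists_implementable := by
    obtain ⟨φ, hφ, hφσ⟩ := hσ.exists_implementable
    exact ⟨φ.symm, hφ.symm, fun u => by rw [φ.symm_apply_eq, hφσ, σ.apply_symm_apply]⟩
  map_pauliX m hm := by rw [σ.symm_apply_eq, hσ.map_pauliX m hm]
  map_pauliZ m hm := by rw [σ.symm_apply_eq, hσ.map_pauliZ m hm]

theorem refl (W : Finset ι) (k : ℕ) : IsClifford W k (LinearEquiv.refl F (PhaseSpace F ι)) :=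
  ⟨⟨_, .refl k, fun _ => rfl⟩, fun _ _ => rfl, fun _ _ => rfl⟩

theorem fourier {i : ι} (hi : i ∈ W) : IsClifford (F := F) W 2 (fourierEquiv i) := by
  refine ⟨⟨_, .fourier i, fourierEquiv_constRow i⟩, fun m hm => ?_, fun m hm => ?_⟩ <;>
  · have hmi : i ≠ m := ne_of_mem_of_not_mem hi hm
    simp [fourierEquiv_apply, pauliX, pauliZ, hmi]

theorem scale (γ : Fˣ) {i : ι} (hi : i ∈ W) : IsClifford W 1 (scaleEquiv γ i) := by
  refine ⟨⟨_, .scale γ i, scaleEquiv_constRow γ i⟩, fun m hm => ?_, fun m hm => ?_⟩ <;>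
  · have hmi : i ≠ m := ne_of_mem_of_not_mem hi hm
    simp [scaleEquiv_apply, pauliX, pauliZ, hmi]

theorem shear (h : F) {i : ι} (hi : i ∈ W) : IsClifford W 1 (shearEquiv i h) := by
  refine ⟨⟨_, .shear_C i h, shearEquiv_constRow i h⟩, fun m hm => ?_, fun m hm => ?_⟩ <;>
  · have hmi : i ≠ m := ne_of_mem_of_not_mem hi hm
    simp [shearEquiv_apply, pauliX, pauliZ, hmi]

theorem add (f : F) {i j : ι} (hij : i ≠ j) (hi : i ∈ W) (hj : j ∈ W) :
    IsClifford W 3 (addEquiv (RingHom.id F) i j hij f) := by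
  refine ⟨⟨_, .add i j hij f 0, fun u => ?_⟩, fun m hm => ?_, fun m hm => ?_⟩
  · rw [T_zero, mul_one, addEquiv_constRow]
  all_goals
    have hmi : i ≠ m := ne_of_mem_of_not_mem hi hm
    have hmj : j ≠ m := ne_of_mem_of_not_mem hj hm
    simp [addEquiv_apply, pauliX, pauliZ, hmi, hmj]

theorem sympl_map [Fintype ι] (hσ : IsClifford W k σ) (u v : PhaseSpace F ι) :
    sympl (σ u) (σ v) = sympl u v := by
  obtain ⟨φ, hφ, hφσ⟩ := hσ.exists_implementable
  have h := hφ.rowForm_apply (constRow u) (constRow v)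
  rw [hφσ, hφσ, rowForm_constRow, rowForm_constRow] at h
  exact LaurentPolynomial.C.injective h

variable [Finite ι]

theorem fst_eq (hσ : IsClifford W k σ) {m : ι} (hm : σ (pauliZ m) = pauliZ m)
    (u : PhaseSpace F ι) : (σ u).1 m = u.1 m := by
  have := Fintype.ofFinite ι
  simpa only [hm, symplecticForm_pauliZ_right] using hσ.sympl_map u (pauliZ m)

theorem snd_eq (hσ : IsClifford W k σ) {m : ι} (hm : σ (pauliX m) = pauliX m)
    (u : PhaseSpace F ι) : (σ u).2 m = u.2 m := by
  have := Fintype.ofFinite ι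
  simpa only [hm, symplecticForm_pauliX_right, neg_inj] using hσ.sympl_map u (pauliX m)

end IsClifford

theorem fourierEquiv_pauliZ (j : ι) : fourierEquiv j (pauliZ j) = (pauliX j : PhaseSpace F ι) := by
  simp [fourierEquiv_apply, pauliX, pauliZ, Pi.single]

theorem fourierEquiv_pauliX (j : ι) :
    fourierEquiv j (pauliX j) = -(pauliZ j : PhaseSpace F ι) := by
  simp [fourierEquiv_apply, pauliX, pauliZ, Pi.single, ← Function.update_neg]

variable {u v y : PhaseSpace F ι}

theorem exists_isClifford_clear_coordinate {i j : ι} (hij : i ≠ j) (hu : u.1 j = 1) :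
    ∃ σ, IsClifford {i, j} 8 σ ∧ σ (pauliZ j) = pauliZ j ∧ (σ u).1 i = 0 ∧ (σ u).2 i = 0 := by
  have hi : i ∈ ({i, j} : Finset ι) := by simp
  have hj : j ∈ ({i, j} : Finset ι) := by simp
  refine ⟨_, ((IsClifford.add (-u.1 i) hij.symm hj hi).trans (.fourier hi)).trans
    (.add (-u.2 i) hij.symm hj hi), ?_, ?_, ?_⟩
  · simp [addEquiv_apply, fourierEquiv_apply, pauliX, pauliZ, hij]
  all_goals simp [addEquiv_apply, fourierEquiv_apply, pauliX, pauliZ, hij, hij.symm, hu]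

theorem exists_isClifford_clear [Finite ι] {j : ι} (hu : u.1 j = 1) (s : Finset ι) (hj : j ∉ s) :
    ∃ σ, IsClifford (insert j s) (8 * s.card) σ ∧ σ (pauliZ j) = pauliZ j ∧
      ∀ i ∈ s, (σ u).1 i = 0 ∧ (σ u).2 i = 0 := by
  induction s using Finset.induction_on with
  | empty => exact ⟨_, .refl _ _, rfl, by simp⟩
  | insert i s hi ih =>
    rw [Finset.mem_insert, not_or] at hj
    obtain ⟨σ, hσ, hσj, hσu⟩ := ih hj.2
    obtain ⟨τ, hτ, hτj, hτu⟩ := exists_isClifford_clear_coordinate (u := σ u) (Ne.symm hj.1)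
      (by rw [hσ.fst_eq hσj, hu])
    have hij : ({i, j} : Finset ι) ⊆ insert j (insert i s) := by grind
    refine ⟨σ.trans τ, ?_, by rw [LinearEquiv.trans_apply, hσj, hτj], fun m hm => ?_⟩
    · rw [Finset.card_insert_of_notMem hi, mul_add_one]
      exact (hσ.mono (by grind) le_rfl).trans (hτ.mono hij le_rfl)
    · rcases eq_or_ne m i with rfl | hmi
      · exact hτu
      · have hms : m ∈ s := Finset.mem_of_mem_insert_of_ne hm hmi
        have hm' : m ∉ ({i, j} : Finset ι) := by grind
        rw [LinearEquiv.trans_apply, hτ.fst_eq (hτ.map_pauliZ m hm'),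
          hτ.snd_eq (hτ.map_pauliX m hm')]
        exact hσu m hms

variable [Fintype ι]

theorem exists_isClifford_pivot {j : ι} (hj : j ∈ W) (hu : u.1 j = 1)
    (hW : ∀ i ∉ W, u.1 i = 0 ∧ u.2 i = 0) :
    ∃ σ, IsClifford W (8 * Fintype.card ι) σ ∧ σ (pauliZ j) = pauliZ j ∧ σ u = pauliX j := by
  obtain ⟨σ, hσ, hσj, hσu⟩ := exists_isClifford_clear hu (W.erase j) (Finset.notMem_erase j W)
  rw [Finset.insert_erase hj] at hσ
  have hcard : 8 * (W.erase j).card + 1 ≤ 8 * Fintype.card ι := by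
    have := (Finset.card_erase_lt_of_mem hj).trans_le W.card_le_univ
    lia
  have vanish (m) (hm : m ≠ j) : (σ u).1 m = 0 ∧ (σ u).2 m = 0 := by
    by_cases hmW : m ∈ W
    · exact hσu m (Finset.mem_erase.2 ⟨hm, hmW⟩)
    · rw [hσ.fst_eq (hσ.map_pauliZ m hmW), hσ.snd_eq (hσ.map_pauliX m hmW)]
      exact hW m hmW
  refine ⟨_, (hσ.trans (.shear (-(σ u).2 j) hj)).mono subset_rfl hcard, ?_, ?_⟩
  · rw [LinearEquiv.trans_apply, hσj]
    simp [shearEquiv_apply, pauliZ]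
  · have hσj : (σ u).1 j = 1 := (hσ.fst_eq hσj u).trans hu
    ext m <;> rcases eq_or_ne m j with rfl | hm <;>
      simp [shearEquiv_apply, pauliX, pauliZ, *]

theorem exists_isClifford_eq_pauliX_of_fst_ne_zero {j : ι} (hu : u.1 j ≠ 0)
    (hW : ∀ i ∉ W, u.1 i = 0 ∧ u.2 i = 0) :
    ∃ σ, IsClifford W (8 * Fintype.card ι + 1) σ ∧ σ u = pauliX j := by
  have hj : j ∈ W := not_not.1 (mt (hW j) (not_and_of_not_left _ hu))
  have hscale := IsClifford.scale (Units.mk0 _ hu) hj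
  obtain ⟨σ, hσ, -, hσu⟩ := exists_isClifford_pivot (u := scaleEquiv (Units.mk0 _ hu) j u) hj
    (by simp [scaleEquiv_apply, hu]) fun i hi => by
      rw [hscale.fst_eq (hscale.map_pauliZ i hi), hscale.snd_eq (hscale.map_pauliX i hi)]
      exact hW i hi
  exact ⟨_, (hscale.trans hσ).mono subset_rfl (add_comm 1 _).le, hσu⟩

theorem exists_isClifford_eq_pauliX (hu : u ≠ 0) (hW : ∀ i ∉ W, u.1 i = 0 ∧ u.2 i = 0) :
    ∃ j ∈ W, ∃ σ, IsClifford W (8 * Fintype.card ι + 3) σ ∧ σ u = pauliX j := by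
  have mem_W {j} (hj : u.1 j ≠ 0 ∨ u.2 j ≠ 0) : j ∈ W :=
    not_not.1 fun h => not_and_or.2 hj (hW j h)
  by_cases! hx : ∃ j, u.1 j ≠ 0
  · obtain ⟨j, hj⟩ := hx
    obtain ⟨σ, hσ, hσu⟩ := exists_isClifford_eq_pauliX_of_fst_ne_zero hj hW
    exact ⟨j, mem_W (.inl hj), σ, hσ.mono subset_rfl (by lia), hσu⟩
  · obtain ⟨j, hj⟩ : ∃ j, u.2 j ≠ 0 := Function.ne_iff.1 fun hz => hu (Prod.ext (funext hx) hz)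
    have hfourier := IsClifford.fourier (F := F) (mem_W (.inr hj))
    obtain ⟨σ, hσ, hσu⟩ := exists_isClifford_eq_pauliX_of_fst_ne_zero (j := j)
      (u := fourierEquiv j u)
      (by simpa [fourierEquiv_apply] using hj) fun i hi => by
        rw [hfourier.fst_eq (hfourier.map_pauliZ i hi), hfourier.snd_eq (hfourier.map_pauliX i hi)]
        exact hW i hi
    exact ⟨j, mem_W (.inr hj), _, (hfourier.trans hσ).mono subset_rfl (by lia), hσu⟩

theorem exists_isClifford_eq_pauliX_pauliZ (huv : sympl u v = 1) :
    ∃ j σ, IsClifford Finset.univ (16 * Fintype.card ι + 7) σ ∧ σ u = pauliX j ∧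
      σ v = pauliZ j := by
  have hu : u ≠ 0 := by
    rintro rfl
    simp at huv
  obtain ⟨j, hj, σ, hσ, hσu⟩ :=
    exists_isClifford_eq_pauliX (W := Finset.univ) hu fun i hi => absurd (Finset.mem_univ i) hi
  have hσv : (σ v).2 j = 1 := by
    rw [← huv, ← hσ.sympl_map, hσu, symplecticForm_pauliX_left, RingHom.id_apply]
  have hfourier := IsClifford.fourier (F := F) hj
  obtain ⟨τ, hτ, hτj, hτv⟩ := exists_isClifford_pivot (u := fourierEquiv j (σ v)) hj
    (by simpa [fourierEquiv_apply] using hσv) fun i hi => absurd (Finset.mem_univ i) hi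
  refine ⟨j, _, (((hσ.trans hfourier).trans hτ).trans hfourier.symm).mono subset_rfl (by lia),
    ?_, ?_⟩
  · rw [LinearEquiv.trans_apply, LinearEquiv.symm_apply_eq, fourierEquiv_pauliX, ← hτj, ← map_neg,
      ← fourierEquiv_pauliX, ← hσu]
    rfl
  · rw [LinearEquiv.trans_apply, LinearEquiv.symm_apply_eq, fourierEquiv_pauliZ, ← hτv]
    rfl

theorem exists_isClifford_eq_pauliX_pauliX (huy : sympl u y = 0)
    (hind : LinearIndependent F ![u, y]) :
    ∃ i j, i ≠ j ∧ ∃ σ, IsClifford Finset.univ (16 * Fintype.card ι + 9) σ ∧ σ u = pauliX i ∧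
      σ y = pauliX j := by
  have hu : u ≠ 0 := hind.ne_zero 0
  obtain ⟨i, -, σ, hσ, hσu⟩ :=
    exists_isClifford_eq_pauliX (W := Finset.univ) hu fun i hi => absurd (Finset.mem_univ i) hi
  have hσy : (σ y).2 i = 0 := by
    rw [← huy, ← hσ.sympl_map, hσu, symplecticForm_pauliX_left, RingHom.id_apply]
  have hne : σ y - (σ y).1 i • pauliX i ≠ 0 := fun h =>
    (LinearIndependent.pair_iff' hu).1 hind ((σ y).1 i) <| σ.injective <| by
      rw [map_smul, hσu, ← sub_eq_zero.1 h]
  obtain ⟨j, hj, τ, hτ, hτy⟩ := exists_isClifford_eq_pauliX (W := {i}ᶜ) hne fun m hm => by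
    obtain rfl : m = i := by simpa using hm
    simp [pauliX, hσy]
  have hji : j ≠ i := by simpa using hj
  have hτi : τ (pauliX i) = pauliX i := hτ.map_pauliX i (by simp)
  refine ⟨i, j, hji.symm, _, ((hσ.trans (hτ.mono (Finset.subset_univ _) le_rfl)).trans
    (.add (-(σ y).1 i) hji (Finset.mem_univ j) (Finset.mem_univ i))).mono subset_rfl (by lia),
    ?_, ?_⟩
  · simp only [LinearEquiv.trans_apply, hσu, hτi, addEquiv_apply]
    simp [pauliX, hji]
  · rw [map_sub, map_smul, hτi, sub_eq_iff_eq_add] at hτy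
    simp only [LinearEquiv.trans_apply, hτy, addEquiv_apply]
    simp [pauliX, hji]

end Clifford

section IsometryFamilies

section ConjFourier

variable {A ι : Type*} [CommRing A] [DecidableEq ι]

theorem shearEquiv_conj_fourierEquiv (i : ι) (h : A) (v : PhaseSpace A ι) :
    (((fourierEquiv i).trans (shearEquiv i h)).trans (fourierEquiv i).symm) v =
      v - (h * v.2 i) • pauliX i := by
  rw [LinearEquiv.trans_apply, LinearEquiv.symm_apply_eq]
  ext m <;> by_cases hm : m = i <;>
    simp [fourierEquiv_apply, shearEquiv_apply, pauliX, pauliZ, hm, neg_add_eq_sub]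

theorem addEquiv_conj_fourierEquiv (σ : A →+* A) (i j : ι) (hij : i ≠ j) (f : A)
    (v : PhaseSpace A ι) :
    (((fourierEquiv i).trans (addEquiv σ i j hij f)).trans (fourierEquiv i).symm) v =
      v + (σ f * v.2 j) • pauliX i + (f * v.2 i) • pauliX j := by
  rw [LinearEquiv.trans_apply, LinearEquiv.symm_apply_eq]
  ext m <;> by_cases hm : m = i <;>
    simp [fourierEquiv_apply, addEquiv_apply, pauliX, pauliZ, hm, hij, hij.symm,
      add_comm (-v.1 i)]

end ConjFourier

variable {F ι : Type*} [Field F] [DecidableEq ι]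

theorem delayEquiv_single (j : ι) (k : ℤ) (x : PauliRow F ι) : delayEquiv (Pi.single j k) x =
    x + ((T k - 1) * x.1 j) • pauliX j + ((T k - 1) * x.2 j) • pauliZ j := by
  ext1 <;> ext1 m <;> by_cases hm : m = j <;> simp [delayEquiv_apply, pauliX, pauliZ, hm, sub_mul]

variable [Fintype ι] {u v y : PhaseSpace F ι}

theorem exists_implementable_delay (huv : sympl u v = 1) (k : ℤ) :
    ∃ φ, Implementable (60 * Fintype.card ι) φ ∧
      ∀ x, φ x = x + ((T k - 1) * rowForm x (constRow v)) • constRow u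
        - ((T k - 1) * rowForm x (constRow u)) • constRow v := by
  obtain ⟨j, σ, hσ, hσu, hσv⟩ := exists_isClifford_eq_pauliX_pauliZ huv
  obtain ⟨φ, hφ, hφσ⟩ := hσ.exists_implementable
  have hn : 0 < Fintype.card ι := Fintype.card_pos_iff.2 ⟨j⟩
  refine ⟨_, (hφ.symm.conj (.delay (Pi.single j k))).mono (by lia), fun x => ?_⟩
  rw [LinearEquiv.trans_apply, LinearEquiv.symm_apply_eq, LinearEquiv.trans_apply,
    LinearEquiv.symm_symm, map_sub, map_add, map_smul, map_smul, ← hφ.rowForm_apply x,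
    ← hφ.rowForm_apply x, hφσ, hφσ, hσu, hσv, delayEquiv_single]
  simp only [constRow_pauliX, constRow_pauliZ, symplecticForm_pauliX_right,
    symplecticForm_pauliZ_right, mul_neg, neg_smul, sub_neg_eq_add]

theorem exists_implementable_transvection [Finite F] (hu : u ≠ 0) (γ : F) {m : ℤ} (hm : m ≠ 0) :
    ∃ φ, Implementable (60 * Fintype.card ι) φ ∧ ∀ x, φ x =
      x + (LaurentPolynomial.C γ * (T m + T (-m)) * rowForm x (constRow u)) • constRow u := by
  obtain ⟨j, -, σ, hσ, hσu⟩ :=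
    exists_isClifford_eq_pauliX (W := Finset.univ) hu fun i hi => absurd (Finset.mem_univ i) hi
  obtain ⟨φ, hφ, hφσ⟩ := hσ.exists_implementable
  have hn : 0 < Fintype.card ι := Fintype.card_pos_iff.2 ⟨j⟩
  refine ⟨_, (hφ.symm.conj ((Implementable.fourier j).symm.conj (.shear j hm γ))).mono (by lia),
    fun x => ?_⟩
  rw [LinearEquiv.trans_apply, LinearEquiv.symm_apply_eq, LinearEquiv.trans_apply,
    LinearEquiv.symm_symm, LinearEquiv.symm_symm, map_add, map_smul, ← hφ.rowForm_apply x, hφσ,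
    hσu, shearEquiv_conj_fourierEquiv]
  simp only [constRow_pauliX, symplecticForm_pauliX_right, mul_neg, neg_smul, ← sub_eq_add_neg]

theorem exists_implementable_siegel (huy : sympl u y = 0) (hind : LinearIndependent F ![u, y])
    (γ : F) (m : ℤ) :
    ∃ φ, Implementable (60 * Fintype.card ι) φ ∧
      ∀ x, φ x = x + (LaurentPolynomial.C γ * T (-m) * rowForm x (constRow y)) • constRow u
        + (LaurentPolynomial.C γ * T m * rowForm x (constRow u)) • constRow y := by
  obtain ⟨i, j, hij, σ, hσ, hσu, hσy⟩ := exists_isClifford_eq_pauliX_pauliX huy hind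
  obtain ⟨φ, hφ, hφσ⟩ := hσ.exists_implementable
  have hn : 0 < Fintype.card ι := Fintype.card_pos_iff.2 ⟨j⟩
  refine ⟨_, (hφ.symm.conj ((Implementable.fourier i).symm.conj (.add i j hij (-γ) m))).mono
    (by lia), fun x => ?_⟩
  have hinv : invertHom F (LaurentPolynomial.C (-γ) * T m) = LaurentPolynomial.C (-γ) * T (-m) := by
    rw [map_mul]
    exact congrArg₂ _ (invert_C _) (invert_T m)
  rw [LinearEquiv.trans_apply, LinearEquiv.symm_apply_eq, LinearEquiv.trans_apply,
    LinearEquiv.symm_symm, LinearEquiv.symm_symm, map_add, map_add, map_smul, map_smul,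
    ← hφ.rowForm_apply x, ← hφ.rowForm_apply x, hφσ, hφσ, hσu, hσy, addEquiv_conj_fourierEquiv,
    hinv]
  simp only [constRow_pauliX, symplecticForm_pauliX_right, map_neg, neg_mul, mul_neg, neg_smul]

end IsometryFamilies

section ToLaurent

variable {F : Type*} [Field F]

theorem coeff_toLaurent_natCast (p : F[X]) (n : ℕ) :
    (toLaurent p).coeff (n : ℤ) = p.coeff n := by
  rw [coeff_toLaurent]
  exact Finsupp.mapDomain_apply Nat.cast_injective _ _

theorem coeff_toLaurent_of_neg (p : F[X]) {k : ℤ} (hk : k < 0) : (toLaurent p).coeff k = 0 := by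
  rw [coeff_toLaurent]
  refine Finsupp.mapDomain_of_notMem_range _ _ ?_
  rintro ⟨n, rfl⟩
  exact absurd hk (not_lt.2 n.cast_nonneg)

theorem exists_toLaurent_eq (f : F[T;T⁻¹]) (hf : ∀ k < 0, f.coeff k = 0) :
    ∃ p : F[X], toLaurent p = f := by
  obtain ⟨n, g, hg⟩ := exists_T_pow f
  have dvd : X ^ n ∣ g := X_pow_dvd_iff.2 fun d hd => by
    rw [← coeff_toLaurent_natCast, hg, mul_comm, coeff_T_mul]
    exact hf _ (by lia)
  obtain ⟨p, rfl⟩ := dvd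
  refine ⟨p, (isUnit_T (R := F) n).mul_right_cancel ?_⟩
  rwa [map_mul, toLaurent_X_pow, mul_comm] at hg

end ToLaurent

section Degree

variable {F ι : Type*} [Field F]

/-- The rows whose coefficients vanish outside the frames in `s`. -/
noncomputable def supportedOn (s : Set ℤ) : Submodule F (PauliRow F ι) :=
  ⨅ k ∉ s, LinearMap.ker (coeffAt k)

/-- The rows without negative powers of `D`. -/
noncomputable abbrev posPart (F ι : Type*) [Field F] : Submodule F (PauliRow F ι) :=
  supportedOn (Set.Ici 0)

/-- The rows with only negative powers of `D`. -/
noncomputable abbrev negPart (F ι : Type*) [Field F] : Submodule F (PauliRow F ι) :=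
  supportedOn (Set.Iio 0)

theorem mem_supportedOn {s : Set ℤ} {x : PauliRow F ι} :
    x ∈ supportedOn s ↔ ∀ k ∉ s, coeffAt k x = 0 := by
  simp [supportedOn, Submodule.mem_iInf]

theorem mem_posPart {x : PauliRow F ι} : x ∈ posPart F ι ↔ ∀ k < 0, coeffAt k x = 0 := by
  simp [mem_supportedOn]

theorem mem_negPart {x : PauliRow F ι} : x ∈ negPart F ι ↔ ∀ k, 0 ≤ k → coeffAt k x = 0 := by
  simp [mem_supportedOn]

theorem disjoint_posPart_negPart : Disjoint (posPart F ι) (negPart F ι) := by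
  refine Submodule.disjoint_def.2 fun x hx hx' => ext_coeffAt fun k => ?_
  rw [map_zero]
  exact (lt_or_ge k 0).elim (mem_posPart.1 hx k) (mem_negPart.1 hx' k)

/-- The rows in `M` that are the sum of a row in `M` without negative powers of `D` and a row in `M`
with only negative powers. -/
noncomputable def splitPart (M : Submodule F[T;T⁻¹] (PauliRow F ι)) : Submodule F M :=
  (posPart F ι).comap (M.subtype.restrictScalars F) ⊔
    (negPart F ι).comap (M.subtype.restrictScalars F)

/-- The degree of `M`, which is the codimension of `splitPart M` over the field, is at most `N`. It
measures how far `M` is from being generated by constant rows. -/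
def DegreeLE (N : ℕ) (M : Submodule F[T;T⁻¹] (PauliRow F ι)) : Prop :=
  Module.Finite F (M ⧸ splitPart M) ∧ Module.finrank F (M ⧸ splitPart M) ≤ N

/-- Under `φ`, the split rows of `M` remain split, and some row of `M` becomes split. -/
structure LowersDegree (φ : PauliRow F ι ≃ₗ[F[T;T⁻¹]] PauliRow F ι)
    (M : Submodule F[T;T⁻¹] (PauliRow F ι)) : Prop where
  map_posPart : ∀ x ∈ M, x ∈ posPart F ι → φ x ∈ posPart F ι
  map_negPart : ∀ x ∈ M, x ∈ negPart F ι → φ x ∈ negPart F ι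
  exists_gain : ∃ p ∈ M,
    (φ p ∈ posPart F ι ∧ p ∉ posPart F ι) ∨ (φ p ∈ negPart F ι ∧ p ∉ negPart F ι)

theorem finrank_quotient_lt {K E : Type*} [Field K] [AddCommGroup E] [Module K E]
    {A B : Submodule K E} (hAB : A < B) [Module.Finite K (E ⧸ A)] :
    Module.Finite K (E ⧸ B) ∧ Module.finrank K (E ⧸ B) < Module.finrank K (E ⧸ A) := by
  obtain ⟨p, hpB, hpA⟩ := SetLike.exists_of_lt hAB
  have surj : Function.Surjective (Submodule.factor hAB.le) := Submodule.factor_surjective hAB.le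
  refine ⟨Module.Finite.of_surjective _ surj, ?_⟩
  have rank_nullity := (Submodule.factor hAB.le).finrank_range_add_finrank_ker
  rw [LinearMap.range_eq_top.2 surj, finrank_top] at rank_nullity
  have ker_pos : 0 < Module.finrank K (LinearMap.ker (Submodule.factor hAB.le)) := by
    rw [Module.finrank_pos_iff_exists_ne_zero]
    exact ⟨⟨Submodule.Quotient.mk p, (Submodule.Quotient.mk_eq_zero B).2 hpB⟩,
      fun h => hpA ((Submodule.Quotient.mk_eq_zero A).1 (congrArg Subtype.val h))⟩
  lia

section Map

variable {M : Submodule F[T;T⁻¹] (PauliRow F ι)} {φ : PauliRow F ι ≃ₗ[F[T;T⁻¹]] PauliRow F ι}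

theorem mem_splitPart {x : M} : x ∈ splitPart M ↔
    ∃ a ∈ M, a ∈ posPart F ι ∧ ∃ b ∈ M, b ∈ negPart F ι ∧ a + b = x := by
  constructor
  · intro hx
    obtain ⟨a, ha, b, hb, rfl⟩ := Submodule.mem_sup.1 hx
    exact ⟨a, a.2, ha, b, b.2, hb, rfl⟩
  · rintro ⟨a, haM, ha, b, hbM, hb, hab⟩
    exact Submodule.mem_sup.2 ⟨⟨a, haM⟩, ha, ⟨b, hbM⟩, hb, Subtype.ext hab⟩

theorem LowersDegree.exists_notMem_splitPart (h : LowersDegree φ M) :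
    ∃ p : M, p ∉ splitPart M ∧ (φ p ∈ posPart F ι ∨ φ p ∈ negPart F ι) := by
  obtain ⟨p, hpM, hp⟩ := h.exists_gain
  refine ⟨⟨p, hpM⟩, fun hsplit => ?_, hp.imp And.left And.left⟩
  obtain ⟨a, haM, ha, b, hbM, hb, rfl⟩ := mem_splitPart.1 hsplit
  have hφa := h.map_posPart a haM ha
  have hφb := h.map_negPart b hbM hb
  have eq_zero {c} (hpos : φ c ∈ posPart F ι) (hneg : φ c ∈ negPart F ι) : c = 0 :=
    φ.map_eq_zero_iff.1 (Submodule.disjoint_def.1 disjoint_posPart_negPart _ hpos hneg)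
  rw [map_add] at hp
  rcases hp with ⟨hφp, hp⟩ | ⟨hφp, hp⟩
  · rw [eq_zero ((Submodule.add_mem_iff_right _ hφa).1 hφp) hφb, add_zero] at hp
    exact hp ha
  · rw [eq_zero hφa ((Submodule.add_mem_iff_left _ hφb).1 hφp), zero_add] at hp
    exact hp hb

theorem DegreeLE.map {N : ℕ} (h : DegreeLE N M) (hφ : LowersDegree φ M) :
    0 < N ∧ DegreeLE (N - 1) (M.map φ.toLinearMap) := by
  let e : M ≃ₗ[F] M.map φ.toLinearMap := (φ.submoduleMap M).restrictScalars F
  have splitPart_lt : splitPart M < (splitPart (M.map φ.toLinearMap)).comap e.toLinearMap := by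
    obtain ⟨p, hp, hφp⟩ := hφ.exists_notMem_splitPart
    refine SetLike.lt_iff_le_and_exists.2 ⟨?_, p, ?_, hp⟩
    · exact sup_le (fun x hx => Submodule.mem_sup_left (hφ.map_posPart x x.2 hx))
        (fun x hx => Submodule.mem_sup_right (hφ.map_negPart x x.2 hx))
    · exact hφp.elim (fun h => Submodule.mem_sup_left h) (fun h => Submodule.mem_sup_right h)
  have := h.1
  obtain ⟨finite, finrank_lt⟩ := finrank_quotient_lt splitPart_lt
  let q := Submodule.Quotient.equiv _ (splitPart (M.map φ.toLinearMap)) e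
    (Submodule.map_comap_eq_of_surjective e.surjective _)
  have finrank_le := h.2
  refine ⟨by lia, Module.Finite.equiv q, ?_⟩
  rw [← q.finrank_eq]
  lia

end Map

/-- The constant coefficients of the rows in `M` without negative powers of `D`. -/
noncomputable def lowSpace (M : Submodule F[T;T⁻¹] (PauliRow F ι)) :
    Submodule F (PhaseSpace F ι) :=
  (M.restrictScalars F ⊓ posPart F ι).map (coeffAt 0)

/-- The constant coefficients of the rows in `M` without positive powers of `D`. -/
noncomputable def highSpace (M : Submodule F[T;T⁻¹] (PauliRow F ι)) :
    Submodule F (PhaseSpace F ι) :=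
  (M.restrictScalars F ⊓ supportedOn (Set.Iic 0)).map (coeffAt 0)

/-- Any two elements of `M` are orthogonal for `rowForm`: all shifts of the corresponding Pauli
matrices commute. -/
def IsIsotropic [Fintype ι] (M : Submodule F[T;T⁻¹] (PauliRow F ι)) : Prop :=
  ∀ x ∈ M, ∀ y ∈ M, rowForm x y = 0

/-- The quotient by `M` is torsion-free. -/
def IsSaturated (M : Submodule F[T;T⁻¹] (PauliRow F ι)) : Prop :=
  ∀ (f : F[T;T⁻¹]) (x : PauliRow F ι), f ≠ 0 → f • x ∈ M → x ∈ M

variable {M : Submodule F[T;T⁻¹] (PauliRow F ι)}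

theorem mem_lowSpace {u : PhaseSpace F ι} :
    u ∈ lowSpace M ↔ ∃ x ∈ M, x ∈ posPart F ι ∧ coeffAt 0 x = u :=
  ⟨fun ⟨x, ⟨hxM, hx⟩, hxu⟩ => ⟨x, hxM, hx, hxu⟩, fun ⟨x, hxM, hx, hxu⟩ => ⟨x, ⟨hxM, hx⟩, hxu⟩⟩

theorem mem_highSpace {u : PhaseSpace F ι} :
    u ∈ highSpace M ↔ ∃ x ∈ M, x ∈ supportedOn (Set.Iic 0) ∧ coeffAt 0 x = u :=
  ⟨fun ⟨x, ⟨hxM, hx⟩, hxu⟩ => ⟨x, hxM, hx, hxu⟩, fun ⟨x, hxM, hx, hxu⟩ => ⟨x, ⟨hxM, hx⟩, hxu⟩⟩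

theorem coeffAt_mem_lowSpace {x : PauliRow F ι} (hx : x ∈ M) {n : ℤ}
    (h : ∀ k < n, coeffAt k x = 0) : coeffAt n x ∈ lowSpace M :=
  mem_lowSpace.2 ⟨(T (-n) : F[T;T⁻¹]) • x, M.smul_mem _ hx,
    mem_posPart.2 fun k hk => by rw [coeffAt_T_smul]; exact h _ (by lia),
    by rw [coeffAt_T_smul, zero_sub, neg_neg]⟩

theorem coeffAt_mem_highSpace {x : PauliRow F ι} (hx : x ∈ M) {n : ℤ}
    (h : ∀ k, n < k → coeffAt k x = 0) : coeffAt n x ∈ highSpace M :=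
  mem_highSpace.2 ⟨(T (-n) : F[T;T⁻¹]) • x, M.smul_mem _ hx,
    mem_supportedOn.2 fun k hk => by
      rw [coeffAt_T_smul]; exact h _ (by rw [Set.mem_Iic] at hk; lia),
    by rw [coeffAt_T_smul, zero_sub, neg_neg]⟩

theorem T_neg_one_smul_notMem_posPart {t : PauliRow F ι} (ht : coeffAt 0 t ≠ 0) :
    (T (-1) : F[T;T⁻¹]) • t ∉ posPart F ι := fun h => ht <| by
  simpa [coeffAt_T_smul] using mem_posPart.1 h (-1) (by lia)

theorem posPart_of_supportedOn_insert {m : ℤ} {t : PauliRow F ι}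
    (ht : t ∈ supportedOn (insert 0 (Set.Ici m))) (hm : 0 ≤ m) : t ∈ posPart F ι :=
  mem_posPart.2 fun k hk => mem_supportedOn.1 ht k (by
    rw [Set.mem_insert_iff, Set.mem_Ici]; lia)

theorem exists_sub_coeffAt_mem_lowSpace {m : ℤ}
    (hlow : ∀ x ∈ M, x ∈ posPart F ι → ∀ k < m, coeffAt k x ∈ lowSpace M) {t : PauliRow F ι}
    (htM : t ∈ M) (ht : t ∈ posPart F ι) (j : ℕ) (hj : j < m) :
    ∃ s ∈ M, s ∈ supportedOn (insert 0 (Set.Ici (j + 1 : ℤ))) ∧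
      coeffAt m t - coeffAt m s ∈ lowSpace M := by
  induction j with
  | zero =>
    refine ⟨t, htM, mem_supportedOn.2 fun k hk => mem_posPart.1 ht k ?_, ?_⟩
    · rw [Set.mem_insert_iff, Set.mem_Ici] at hk
      lia
    · rw [sub_self]
      exact zero_mem _
  | succ j ih =>
    obtain ⟨s, hsM, hs, hsub⟩ := ih (by lia)
    have hs_pos := posPart_of_supportedOn_insert hs (by lia)
    obtain ⟨r, hrM, hr, hr_zero⟩ := mem_lowSpace.1 (hlow s hsM hs_pos (j + 1) (by lia))
    refine ⟨s - (T (j + 1) : F[T;T⁻¹]) • r, M.sub_mem hsM (M.smul_mem _ hrM),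
      mem_supportedOn.2 fun k hk => ?_, ?_⟩
    · rw [Set.mem_insert_iff, Set.mem_Ici, not_or, not_le] at hk
      push_cast at hk
      rw [map_sub, coeffAt_T_smul]
      rcases eq_or_ne k (j + 1) with rfl | hkj
      · rw [sub_self, hr_zero, sub_self]
      · rw [mem_posPart.1 hr _ (by lia), sub_zero]
        refine mem_supportedOn.1 hs k ?_
        rw [Set.mem_insert_iff, Set.mem_Ici]
        lia
    · rw [map_sub, coeffAt_T_smul, sub_sub_eq_add_sub, add_sub_right_comm]
      exact add_mem hsub (hlow r hrM hr _ (by lia))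

theorem coeffAt_zero_ne_zero {m : ℤ} {t : PauliRow F ι} (htM : t ∈ M)
    (ht : t ∈ supportedOn (insert 0 (Set.Ici m))) (htm : coeffAt m t ∉ lowSpace M) :
    coeffAt 0 t ≠ 0 := fun h0 =>
  htm <| coeffAt_mem_lowSpace htM fun k hk => by
    rcases eq_or_ne k 0 with rfl | hk0
    · exact h0
    · exact mem_supportedOn.1 ht k (by rw [Set.mem_insert_iff, Set.mem_Ici]; lia)

theorem exists_T_smul_mem_posPart [Finite ι] (x : PauliRow F ι) :
    ∃ n : ℕ, (T n : F[T;T⁻¹]) • x ∈ posPart F ι := by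
  have := Fintype.ofFinite ι
  have exists_order (f : F[T;T⁻¹]) : ∃ n : ℕ, ∀ k < -(n : ℤ), f.coeff k = 0 := by
    obtain ⟨n, g, hg⟩ := exists_T_pow f
    refine ⟨n, fun k hk => ?_⟩
    have h := coeff_toLaurent_of_neg g (k := k + n) (by lia)
    rwa [hg, mul_comm, coeff_T_mul, add_sub_cancel_right] at h
  choose n hn using exists_order
  have le_sum (i : ι) : n (x.1 i) + n (x.2 i) ≤ ∑ i, (n (x.1 i) + n (x.2 i)) :=
    Finset.single_le_sum (f := fun i => n (x.1 i) + n (x.2 i)) (fun _ _ => Nat.zero_le _)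
      (Finset.mem_univ i)
  refine ⟨∑ i, (n (x.1 i) + n (x.2 i)), mem_posPart.2 fun k hk => ?_⟩
  rw [coeffAt_T_smul]
  ext i
  · exact hn _ _ (by have := le_sum i; lia)
  · exact hn _ _ (by have := le_sum i; lia)

section Isotropic

variable [Fintype ι]

theorem IsIsotropic.sympl_coeffAt_eq_zero (hM : IsIsotropic M) {x t : PauliRow F ι} (hxM : x ∈ M)
    (htM : t ∈ M) (hx : x ∈ supportedOn (Set.Iic 0)) {m : ℤ}
    (ht : t ∈ supportedOn (insert 0 (Set.Ici m))) {k : ℤ} (hk : -m < k) :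
    sympl (coeffAt k x) (coeffAt 0 t) = 0 := by
  set t' : PauliRow F ι := (T (-m) : F[T;T⁻¹]) • (t - constRow (coeffAt 0 t)) with ht'
  have t_eq : t = constRow (coeffAt 0 t) + (T m : F[T;T⁻¹]) • t' := by
    rw [ht', smul_smul, ← T_add, add_neg_cancel, T_zero, one_smul, add_sub_cancel]
  have t'_pos : ∀ k < 0, coeffAt k t' = 0 := by
    intro k hk
    rw [ht', coeffAt_T_smul, map_sub, coeffAt_constRow]
    split_ifs with h0
    · rw [h0, sub_self]
    · rw [sub_zero, mem_supportedOn.1 ht _ (by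
        rw [Set.mem_insert_iff, Set.mem_Ici]; lia)]
  have x_nonpos : ∀ k, 0 < k → coeffAt k x = 0 := fun k hk =>
    mem_supportedOn.1 hx k (not_le.2 hk)
  have shift_eq_zero : (rowForm x ((T m : F[T;T⁻¹]) • t')).coeff k = 0 := by
    have hT : invertHom F (T m) = T (-m) := invert_T m
    rw [map_smulₛₗ, hT, smul_eq_mul, coeff_T_mul]
    exact coeff_rowForm_eq_zero x_nonpos t'_pos (by lia)
  have isotropic := hM x hxM t htM
  rw [t_eq, map_add] at isotropic
  have expand := congrArg (fun f => f.coeff k) isotropic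
  simp only [AddMonoidAlgebra.coeff_add, Finsupp.add_apply, shift_eq_zero, add_zero,
    coeff_rowForm_constRow] at expand
  exact expand

theorem IsIsotropic.sympl_highSpace_lowSpace (hM : IsIsotropic M) {u w : PhaseSpace F ι}
    (hu : u ∈ highSpace M) (hw : w ∈ lowSpace M) : sympl u w = 0 := by
  obtain ⟨x, hxM, hx, rfl⟩ := mem_highSpace.1 hu
  obtain ⟨t, htM, ht, rfl⟩ := mem_lowSpace.1 hw
  refine hM.sympl_coeffAt_eq_zero (m := 1) hxM htM hx ?_ (by lia)
  refine mem_supportedOn.2 fun k hk => mem_posPart.1 ht k ?_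
  rw [Set.mem_insert_iff, Set.mem_Ici] at hk
  lia

theorem exists_sympl_eq_one_of_notMem (L : Submodule F (PhaseSpace F ι)) {u : PhaseSpace F ι}
    (hu : u ∉ L) : ∃ y, (∀ l ∈ L, sympl l y = 0) ∧ sympl u y = 1 := by
  rw [← LinearMap.BilinForm.orthogonal_orthogonal sympl_nondegenerate sympl_isRefl L,
    LinearMap.BilinForm.mem_orthogonal_iff] at hu
  push Not at hu
  obtain ⟨y, hy, hyu⟩ := hu
  rw [LinearMap.BilinForm.mem_orthogonal_iff] at hy
  have hyu' : sympl u y ≠ 0 := fun h => hyu (sympl_isRefl _ _ h)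
  refine ⟨(sympl u y)⁻¹ • y, fun l hl => ?_, ?_⟩
  · rw [map_smul, show sympl l y = 0 from hy l hl, smul_zero]
  · rw [map_smul, smul_eq_mul, inv_mul_cancel₀ hyu']

section Gain

variable [DecidableEq ι]

theorem exists_implementable_coeffAt_delay {u v : PhaseSpace F ι} (huv : sympl u v = 1) (n : ℤ) :
    ∃ φ : PauliRow F ι ≃ₗ[F[T;T⁻¹]] PauliRow F ι, Implementable (60 * Fintype.card ι) φ ∧
      ∀ x k, coeffAt k (φ x) = coeffAt k x
        + (sympl (coeffAt (k - n) x) v - sympl (coeffAt k x) v) • u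
        - (sympl (coeffAt (k - n) x) u - sympl (coeffAt k x) u) • v := by
  obtain ⟨φ, hφ, φ_apply⟩ := exists_implementable_delay huv n
  refine ⟨φ, hφ, fun x k => ?_⟩
  rw [φ_apply, map_sub, map_add, coeffAt_smul_constRow, coeffAt_smul_constRow]
  simp only [sub_mul, one_mul, AddMonoidAlgebra.coeff_sub, Finsupp.sub_apply, coeff_T_mul,
    coeff_rowForm_constRow]

theorem exists_implementable_coeffAt_siegel {u y : PhaseSpace F ι} (huy : sympl u y = 0)
    (hind : LinearIndependent F ![u, y]) (m : ℤ) :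
    ∃ φ : PauliRow F ι ≃ₗ[F[T;T⁻¹]] PauliRow F ι, Implementable (60 * Fintype.card ι) φ ∧
      ∀ x k, coeffAt k (φ x) = coeffAt k x - sympl (coeffAt (k + m) x) y • u
        - sympl (coeffAt (k - m) x) u • y := by
  obtain ⟨φ, hφ, φ_apply⟩ := exists_implementable_siegel huy hind (-1) m
  refine ⟨φ, hφ, fun x k => ?_⟩
  rw [φ_apply, map_add, map_add, coeffAt_smul_constRow, coeffAt_smul_constRow, mul_assoc,
    mul_assoc, ← LaurentPolynomial.smul_eq_C_mul, ← LaurentPolynomial.smul_eq_C_mul]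
  simp only [AddMonoidAlgebra.coeff_smul, Finsupp.smul_apply, coeff_T_mul, coeff_rowForm_constRow,
    sub_neg_eq_add]
  module

theorem exists_implementable_coeffAt_transvection [Finite F] {u : PhaseSpace F ι} (hu : u ≠ 0)
    (γ : F) {m : ℤ} (hm : m ≠ 0) :
    ∃ φ : PauliRow F ι ≃ₗ[F[T;T⁻¹]] PauliRow F ι, Implementable (60 * Fintype.card ι) φ ∧
      ∀ x k, coeffAt k (φ x) = coeffAt k x +
        (γ * (sympl (coeffAt (k - m) x) u + sympl (coeffAt (k + m) x) u)) • u := by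
  obtain ⟨φ, hφ, φ_apply⟩ := exists_implementable_transvection hu γ hm
  refine ⟨φ, hφ, fun x k => ?_⟩
  rw [φ_apply, map_add, coeffAt_smul_constRow, mul_assoc, ← LaurentPolynomial.smul_eq_C_mul,
    add_mul]
  simp only [AddMonoidAlgebra.coeff_smul, AddMonoidAlgebra.coeff_add, Finsupp.smul_apply,
    Finsupp.add_apply, coeff_T_mul, coeff_rowForm_constRow, sub_neg_eq_add, smul_eq_mul]

theorem IsIsotropic.exists_lowersDegree_of_notMem_highSpace (hM : IsIsotropic M)
    {u : PhaseSpace F ι} (hu : u ∈ lowSpace M) (hu' : u ∉ highSpace M) :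
    ∃ φ, Implementable (60 * Fintype.card ι) φ ∧ LowersDegree φ M := by
  obtain ⟨v, hv, huv⟩ := exists_sympl_eq_one_of_notMem _ hu'
  obtain ⟨φ, hφ, coeffAt_φ⟩ := exists_implementable_coeffAt_delay huv 1
  obtain ⟨t, htM, ht, rfl⟩ := mem_lowSpace.1 hu
  rw [mem_posPart] at ht
  refine ⟨φ, hφ, fun x _ hx => mem_posPart.2 fun k hk => ?_,
    fun x hxM hx => mem_negPart.2 fun k hk => ?_, (T (-1) : F[T;T⁻¹]) • t, M.smul_mem _ htM,
    Or.inl ⟨mem_posPart.2 fun k hk => ?_, T_neg_one_smul_notMem_posPart fun h => ?_⟩⟩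
  · rw [mem_posPart] at hx
    simp [coeffAt_φ, hx k hk, hx (k - 1) (by lia)]
  · rw [mem_negPart] at hx
    have hmem : coeffAt (k - 1) x ∈ highSpace M :=
      coeffAt_mem_highSpace hxM fun j hj => hx j (by lia)
    simp [coeffAt_φ, hx k hk, hv _ hmem, hM.sympl_highSpace_lowSpace hmem hu]
  · rw [coeffAt_φ, coeffAt_T_smul, coeffAt_T_smul, ht (k - 1 - -1) (by lia)]
    rcases eq_or_ne k (-1) with rfl | hk'
    · simp [huv, sympl_self]
    · rw [ht (k - -1) (by lia)]; simp
  · exact hu' (h ▸ zero_mem _)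

theorem IsIsotropic.exists_lowersDegree_of_notMem_lowSpace (hM : IsIsotropic M)
    {u : PhaseSpace F ι} (hu : u ∈ highSpace M) (hu' : u ∉ lowSpace M) :
    ∃ φ, Implementable (60 * Fintype.card ι) φ ∧ LowersDegree φ M := by
  obtain ⟨v, hv, huv⟩ := exists_sympl_eq_one_of_notMem _ hu'
  obtain ⟨φ, hφ, coeffAt_φ⟩ := exists_implementable_coeffAt_delay huv (-1)
  obtain ⟨t, htM, ht, rfl⟩ := mem_highSpace.1 hu
  replace ht (k : ℤ) (hk : 0 < k) : coeffAt k t = 0 := mem_supportedOn.1 ht k (not_le.2 hk)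
  refine ⟨φ, hφ, fun x hxM hx => mem_posPart.2 fun k hk => ?_,
    fun x _ hx => mem_negPart.2 fun k hk => ?_, t, htM,
    Or.inr ⟨mem_negPart.2 fun k hk => ?_, fun h => ?_⟩⟩
  · rw [mem_posPart] at hx
    have hmem : coeffAt (k - -1) x ∈ lowSpace M :=
      coeffAt_mem_lowSpace hxM fun j hj => hx j (by lia)
    have sympl_eq_zero := sympl_isRefl _ _ (hM.sympl_highSpace_lowSpace hu hmem)
    rw [coeffAt_φ, hx k hk, hv _ hmem, sympl_eq_zero]
    simp
  · rw [mem_negPart] at hx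
    rw [coeffAt_φ, hx k hk, hx (k - -1) (by lia)]
    simp
  · rw [coeffAt_φ, ht (k - -1) (by lia)]
    rcases eq_or_ne k 0 with rfl | hk'
    · simp [huv, sympl_self]
    · simp [ht k (by lia)]
  · exact hu' (mem_negPart.1 h 0 le_rfl ▸ zero_mem _)

end Gain

section Minimal

variable {m : ℤ} {t : PauliRow F ι}

theorem IsIsotropic.sympl_eq_zero_of_mem_negPart (hM : IsIsotropic M) (htM : t ∈ M)
    (ht : t ∈ supportedOn (insert 0 (Set.Ici m))) {x : PauliRow F ι} (hxM : x ∈ M)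
    (hx : x ∈ negPart F ι) {k : ℤ} (hk : -m ≤ k) : sympl (coeffAt k x) (coeffAt 0 t) = 0 := by
  have hTx : (T 1 : F[T;T⁻¹]) • x ∈ supportedOn (Set.Iic 0) := mem_supportedOn.2 fun k hk => by
    rw [Set.mem_Iic] at hk
    rw [coeffAt_T_smul]
    exact mem_negPart.1 hx _ (by lia)
  have h := hM.sympl_coeffAt_eq_zero (M.smul_mem _ hxM) htM hTx ht (k := k + 1) (by lia)
  rwa [coeffAt_T_smul, add_sub_cancel_right] at h

variable [DecidableEq ι]

theorem IsIsotropic.exists_lowersDegree_of_sympl_eq_zero (hM : IsIsotropic M)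
    (hlow : ∀ x ∈ M, x ∈ posPart F ι → ∀ k < m, coeffAt k x ∈ lowSpace M) (hm : 0 < m)
    (htM : t ∈ M) (ht : t ∈ supportedOn (insert 0 (Set.Ici m)))
    (htm : coeffAt m t ∉ lowSpace M) (h0 : sympl (coeffAt m t) (coeffAt 0 t) = 0) :
    ∃ φ, Implementable (60 * Fintype.card ι) φ ∧ LowersDegree φ M := by
  have htpos := posPart_of_supportedOn_insert ht hm.le
  set u := coeffAt 0 t with hu
  have hu_low : u ∈ lowSpace M := mem_lowSpace.2 ⟨t, htM, htpos, rfl⟩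
  have hu0 : u ≠ 0 := coeffAt_zero_ne_zero htM ht htm
  obtain ⟨y, hy, hty⟩ := exists_sympl_eq_one_of_notMem _ htm
  have hind : LinearIndependent F ![u, y] := (LinearIndependent.pair_iff' hu0).2 fun a hay => by
    rw [← hay, map_smul, h0, smul_zero] at hty
    exact zero_ne_one hty
  obtain ⟨φ, hφ, coeffAt_φ⟩ := exists_implementable_coeffAt_siegel (hy u hu_low) hind m
  refine ⟨φ, hφ, fun x hxM hx => mem_posPart.2 fun k hk => ?_,
    fun x hxM hx => mem_negPart.2 fun k hk => ?_, (T (-1) : F[T;T⁻¹]) • t, M.smul_mem _ htM,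
    Or.inl ⟨mem_posPart.2 fun k hk => ?_, T_neg_one_smul_notMem_posPart hu0⟩⟩
  · rw [coeffAt_φ, mem_posPart.1 hx k hk, mem_posPart.1 hx (k - m) (by lia),
      hy _ (hlow x hxM hx _ (by lia))]
    simp
  · rw [coeffAt_φ, mem_negPart.1 hx k hk, mem_negPart.1 hx (k + m) (by lia),
      hM.sympl_eq_zero_of_mem_negPart htM ht hxM hx (by lia)]
    simp
  · have htu : sympl (coeffAt (k - -1 - m) t) u = 0 := by
      rw [mem_posPart.1 htpos _ (by lia), map_zero, LinearMap.zero_apply]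
    rw [map_smul, coeffAt_T_smul, coeffAt_φ, htu]
    rcases eq_or_ne k (-1) with rfl | hk'
    · simp [hty, ← hu]
    · rw [mem_posPart.1 htpos _ (by lia), hy _ (hlow t htM htpos _ (by lia))]
      simp

theorem IsIsotropic.exists_lowersDegree_of_sympl_ne_zero [Finite F] (hM : IsIsotropic M)
    (hL : lowSpace M ≤ highSpace M)
    (hlow : ∀ x ∈ M, x ∈ posPart F ι → ∀ k < m, coeffAt k x ∈ lowSpace M) (hm : 0 < m)
    (htM : t ∈ M) (ht : t ∈ supportedOn (insert 0 (Set.Ici m)))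
    (h0 : sympl (coeffAt m t) (coeffAt 0 t) ≠ 0) :
    ∃ φ, Implementable (60 * Fintype.card ι) φ ∧ LowersDegree φ M := by
  have htpos := posPart_of_supportedOn_insert ht hm.le
  set u := coeffAt 0 t with hu
  have hu0 : u ≠ 0 := fun h => h0 (by rw [h, map_zero])
  have hu_low : u ∈ lowSpace M := mem_lowSpace.2 ⟨t, htM, htpos, rfl⟩
  have hpos {x} (hxM : x ∈ M) (hx : x ∈ posPart F ι) {k : ℤ} (hk : k < m) :
      sympl (coeffAt k x) u = 0 :=
    hM.sympl_highSpace_lowSpace (hL (hlow x hxM hx k hk)) hu_low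
  obtain ⟨φ, hφ, coeffAt_φ⟩ :=
    exists_implementable_coeffAt_transvection hu0 (-(sympl (coeffAt m t) u)⁻¹) hm.ne'
  refine ⟨φ, hφ, fun x hxM hx => mem_posPart.2 fun k hk => ?_,
    fun x hxM hx => mem_negPart.2 fun k hk => ?_, (T (-1) : F[T;T⁻¹]) • t, M.smul_mem _ htM,
    Or.inl ⟨mem_posPart.2 fun k hk => ?_, T_neg_one_smul_notMem_posPart hu0⟩⟩
  · rw [coeffAt_φ, mem_posPart.1 hx k hk, hpos hxM hx (by lia), hpos hxM hx (by lia)]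
    simp
  · rw [coeffAt_φ, mem_negPart.1 hx k hk, mem_negPart.1 hx (k + m) (by lia),
      hM.sympl_eq_zero_of_mem_negPart htM ht hxM hx (by lia)]
    simp
  · rw [map_smul, coeffAt_T_smul, coeffAt_φ, hpos htM htpos (k := k - -1 - m) (by lia)]
    rcases eq_or_ne k (-1) with rfl | hk'
    · simp [h0, ← hu]
    · rw [mem_posPart.1 htpos (k - -1) (by lia), hpos htM htpos (k := k - -1 + m) (by lia)]
      simp

theorem IsIsotropic.exists_lowersDegree_of_coeffAt_notMem_lowSpace [Finite F]
    (hM : IsIsotropic M) (hL : lowSpace M ≤ highSpace M)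
    (h : ∃ n : ℕ, ∃ t ∈ M, t ∈ posPart F ι ∧ coeffAt (n : ℤ) t ∉ lowSpace M) :
    ∃ φ, Implementable (60 * Fintype.card ι) φ ∧ LowersDegree φ M := by
  classical
  obtain ⟨t, htM, ht, htn⟩ := Nat.find_spec h
  set n := Nat.find h
  have hlow : ∀ x ∈ M, x ∈ posPart F ι → ∀ k < (n : ℤ), coeffAt k x ∈ lowSpace M := by
    intro x hxM hx k hk
    rcases lt_or_ge k 0 with hk0 | hk0
    · rw [mem_posPart.1 hx k hk0]
      exact zero_mem _
    · lift k to ℕ using hk0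
      by_contra hxk
      exact Nat.find_min h (by lia) ⟨x, hxM, hx, hxk⟩
  have hn0 : n ≠ 0 := fun h0 => htn (mem_lowSpace.2 ⟨t, htM, ht, by rw [h0, Nat.cast_zero]⟩)
  obtain ⟨s, hsM, hs, hsub⟩ := exists_sub_coeffAt_mem_lowSpace hlow htM ht (n - 1) (by lia)
  rw [show ((n - 1 : ℕ) : ℤ) + 1 = n by lia] at hs
  have hsn : coeffAt (n : ℤ) s ∉ lowSpace M := fun hmem =>
    htn (((lowSpace M).sub_mem_iff_left hmem).1 hsub)
  by_cases h0 : sympl (coeffAt (n : ℤ) s) (coeffAt 0 s) = 0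
  · exact hM.exists_lowersDegree_of_sympl_eq_zero hlow (by lia) hsM hs hsn h0
  · exact hM.exists_lowersDegree_of_sympl_ne_zero hL hlow (by lia) hsM hs h0

end Minimal

theorem exists_sympl_dual {κ : Type*} [DecidableEq κ] {b : κ → PhaseSpace F ι}
    (hb : LinearIndependent F b) :
    ∃ y : κ → PhaseSpace F ι, ∀ i j, sympl (b i) (y j) = if i = j then 1 else 0 := by
  have dual (j : κ) : ∃ y, ∀ i, sympl (b i) y = if i = j then 1 else 0 := by
    obtain ⟨y, hy, hjy⟩ :=
      exists_sympl_eq_one_of_notMem _ (hb.notMem_span_image (s := {j}ᶜ) (x := j) (by simp))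
    refine ⟨y, fun i => ?_⟩
    split_ifs with hij
    · rw [hij, hjy]
    · exact hy _ (Submodule.subset_span ⟨i, by simpa using hij, rfl⟩)
  choose y hy using dual
  exact ⟨y, fun i j => hy j i⟩

theorem eq_sum_rowForm_smul_constRow {κ : Type*} [Fintype κ] [DecidableEq κ]
    {b y : κ → PhaseSpace F ι} (hy : ∀ i j, sympl (b i) (y j) = if i = j then 1 else 0)
    {x : PauliRow F ι} (hx : ∀ k, coeffAt k x ∈ Submodule.span F (Set.range b)) :
    x = ∑ j, rowForm x (constRow (y j)) • constRow (b j) := by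
  refine ext_coeffAt fun k => ?_
  obtain ⟨c, hc⟩ := (Submodule.mem_span_range_iff_exists_fun F).1 (hx k)
  simp only [map_sum, coeffAt_smul_constRow, coeff_rowForm_constRow, ← hc, LinearMap.sum_apply,
    map_smul, LinearMap.smul_apply, hy]
  simp

end Isotropic

theorem det_smul_mem {R E κ : Type*} [CommRing R] [AddCommGroup E] [Module R E] [Fintype κ]
    [DecidableEq κ] (A : Matrix κ κ R) (e : κ → E) {N : Submodule R E}
    (h : ∀ i, ∑ j, A i j • e j ∈ N) (j : κ) : A.det • e j ∈ N := by
  have cramer : A.det • e j = ∑ i, A.adjugate j i • ∑ k, A i k • e k := by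
    simp only [Finset.smul_sum, smul_smul]
    rw [Finset.sum_comm]
    simp only [← Finset.sum_smul, ← Matrix.mul_apply, Matrix.adjugate_mul]
    simp [Matrix.one_apply, ite_smul]
  rw [cramer]
  exact N.sum_mem fun i _ => N.smul_mem _ (h i)

theorem det_ne_zero_of_coeff_zero_eq_one {κ : Type*} [Fintype κ] [DecidableEq κ]
    {A : Matrix κ κ F[T;T⁻¹]} (hneg : ∀ i j, ∀ k < 0, (A i j).coeff k = 0)
    (hzero : ∀ i j, (A i j).coeff 0 = (1 : Matrix κ κ F) i j) : A.det ≠ 0 := by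
  choose p hp using fun i j => exists_toLaurent_eq (A i j) (hneg i j)
  have A_eq : A = (toLaurent (R := F)).mapMatrix (Matrix.of p) := by
    ext1 i j
    exact (hp i j).symm
  have p_zero : (Polynomial.evalRingHom 0).mapMatrix (Matrix.of p) = (1 : Matrix κ κ F) := by
    ext i j
    have coeff_zero := coeff_toLaurent_natCast (p i j) 0
    rw [Nat.cast_zero, hp, hzero, Polynomial.coeff_zero_eq_eval_zero] at coeff_zero
    exact coeff_zero.symm
  rw [A_eq, ← RingHom.map_det, ne_eq, toLaurent_eq_zero]
  intro hdet
  have eval_det := (Polynomial.evalRingHom (0 : F)).map_det (Matrix.of p)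
  rw [hdet, map_zero, p_zero, Matrix.det_one] at eval_det
  exact zero_ne_one eval_det

theorem coeffAt_mem_lowSpace_of_forall_posPart [Finite ι]
    (h : ∀ t ∈ M, t ∈ posPart F ι → ∀ n : ℕ, coeffAt (n : ℤ) t ∈ lowSpace M) {x : PauliRow F ι}
    (hx : x ∈ M) (k : ℤ) : coeffAt k x ∈ lowSpace M := by
  obtain ⟨n, hn⟩ := exists_T_smul_mem_posPart x
  have shift : coeffAt k x = coeffAt (k + n) ((T n : F[T;T⁻¹]) • x) := by
    rw [coeffAt_T_smul, add_sub_cancel_right]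
  rw [shift]
  rcases lt_or_ge (k + n) 0 with h0 | h0
  · rw [mem_posPart.1 hn _ h0]
    exact zero_mem _
  · obtain ⟨j, hj⟩ := Int.eq_ofNat_of_zero_le h0
    rw [hj]
    exact h _ (M.smul_mem _ hx) hn j

theorem IsSaturated.constRow_mem_of_eq_sum {κ : Type*} [Fintype κ] [DecidableEq κ]
    (hsat : IsSaturated M) {b : κ → PhaseSpace F ι} {A : Matrix κ κ F[T;T⁻¹]} (hA : A.det ≠ 0)
    {x : κ → PauliRow F ι} (hxM : ∀ i, x i ∈ M) (hx : ∀ i, x i = ∑ j, A i j • constRow (b j))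
    (j : κ) : constRow (b j) ∈ M :=
  hsat A.det _ hA (det_smul_mem A (fun j => constRow (b j)) (fun i => hx i ▸ hxM i) j)

theorem IsSaturated.le_span_constRow [Finite ι] (hsat : IsSaturated M)
    (h : ∀ t ∈ M, t ∈ posPart F ι → ∀ n : ℕ, coeffAt (n : ℤ) t ∈ lowSpace M) :
    M ≤ Submodule.span F[T;T⁻¹] (constRow '' {u | constRow u ∈ M}) := by
  classical
  have := Fintype.ofFinite ι
  let b := Module.finBasis F (lowSpace M)
  have span_b : Submodule.span F (Set.range fun i => (b i : PhaseSpace F ι)) = lowSpace M := by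
    rw [← Function.comp_def Subtype.val, Set.range_comp, ← (lowSpace M).coe_subtype,
      Submodule.span_image, b.span_eq, Submodule.map_top, Submodule.range_subtype]
  obtain ⟨y, hy⟩ := exists_sympl_dual
    (b.linearIndependent.map' (lowSpace M).subtype (Submodule.ker_subtype _))
  have expansion {x} (hx : x ∈ M) : x = ∑ j, rowForm x (constRow (y j)) • constRow (b j).1 :=
    eq_sum_rowForm_smul_constRow hy fun k =>
      span_b.symm ▸ coeffAt_mem_lowSpace_of_forall_posPart h hx k
  choose x hxM hx hx_zero using fun i => mem_lowSpace.1 (b i).2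
  have det_ne_zero : (Matrix.of fun i j => rowForm (x i) (constRow (y j))).det ≠ 0 := by
    refine det_ne_zero_of_coeff_zero_eq_one (fun i j k hk => ?_) fun i j => ?_
    · rw [Matrix.of_apply, coeff_rowForm_constRow, mem_posPart.1 (hx i) k hk, map_zero,
        LinearMap.zero_apply]
    · rw [Matrix.of_apply, coeff_rowForm_constRow, hx_zero, Matrix.one_apply]
      exact hy i j
  have constRow_mem := hsat.constRow_mem_of_eq_sum det_ne_zero hxM fun i => expansion (hxM i)
  intro z hz
  rw [expansion hz]
  exact Submodule.sum_mem _ fun j _ =>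
    Submodule.smul_mem _ _ (Submodule.subset_span ⟨_, constRow_mem j, rfl⟩)

theorem IsIsotropic.exists_lowersDegree_or_le_span_constRow [Fintype ι] [DecidableEq ι] [Finite F]
    (hM : IsIsotropic M) (hsat : IsSaturated M) :
    (∃ φ, Implementable (60 * Fintype.card ι) φ ∧ LowersDegree φ M) ∨
      M ≤ Submodule.span F[T;T⁻¹] (constRow '' {u | constRow u ∈ M}) := by
  by_cases hlow : lowSpace M ≤ highSpace M
  · by_cases hhigh : highSpace M ≤ lowSpace M
    · by_cases h : ∃ n : ℕ, ∃ t ∈ M, t ∈ posPart F ι ∧ coeffAt (n : ℤ) t ∉ lowSpace M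
      · exact Or.inl (hM.exists_lowersDegree_of_coeffAt_notMem_lowSpace hlow h)
      · push Not at h
        exact Or.inr (hsat.le_span_constRow fun t htM ht n => h n t htM ht)
    · obtain ⟨u, hu, hu'⟩ := SetLike.not_le_iff_exists.1 hhigh
      exact Or.inl (hM.exists_lowersDegree_of_notMem_lowSpace hu hu')
  · obtain ⟨u, hu, hu'⟩ := SetLike.not_le_iff_exists.1 hlow
    exact Or.inl (hM.exists_lowersDegree_of_notMem_highSpace hu hu')

end Degree

section Trivial

variable {F ρ ι : Type*} [Field F] [DecidableEq ι] (a : ρ ↪ ι) (i : ρ)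

theorem row_trivialX : (Stabilizer.trivialX (F := F) a).row i = pauliX (a i) := by
  ext1 <;> ext1 j <;> by_cases h : j = a i <;>
    simp [Stabilizer.row, Stabilizer.trivialX, pauliX, h]

theorem row_trivialZ : (Stabilizer.trivialZ (F := F) a).row i = pauliZ (a i) := by
  ext1 <;> ext1 j <;> by_cases h : j = a i <;>
    simp [Stabilizer.row, Stabilizer.trivialZ, pauliZ, h]

end Trivial

section Encoding

variable {F ι : Type*} [Field F]

/-- The stabilizer generated by the `X`-rows of the qudits in `J`. -/
noncomputable def xSpace [DecidableEq ι] (J : Finset ι) : Submodule F[T;T⁻¹] (PauliRow F ι) :=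
  Submodule.span _ (pauliX '' (J : Set ι))

theorem IsSaturated.map {M : Submodule F[T;T⁻¹] (PauliRow F ι)} (hM : IsSaturated M)
    (φ : PauliRow F ι ≃ₗ[F[T;T⁻¹]] PauliRow F ι) : IsSaturated (M.map φ.toLinearMap) := by
  rintro f x hf ⟨y, hy, hyx⟩
  refine ⟨φ.symm x, hM f _ hf ?_, φ.apply_symm_apply x⟩
  rwa [← map_smul, φ.symm_apply_eq.2 hyx.symm]

variable [DecidableEq ι] {M : Submodule F[T;T⁻¹] (PauliRow F ι)} {J : Finset ι}

theorem pauliX_mem_xSpace {j : ι} (hj : j ∈ J) : (pauliX j : PauliRow F ι) ∈ xSpace J :=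
  Submodule.subset_span ⟨j, hj, rfl⟩

theorem xSpace_le : xSpace J ≤ M ↔ ∀ j ∈ J, pauliX j ∈ M := by
  rw [xSpace, Submodule.span_le, Set.image_subset_iff]
  rfl

theorem map_delayEquiv_xSpace (t : ι → ℤ) (J : Finset ι) :
    (xSpace (F := F) J).map (delayEquiv t).toLinearMap = xSpace J := by
  refine le_antisymm (Submodule.map_le_iff_le_comap.2 (xSpace_le.2 fun j hj => ?_))
    (xSpace_le.2 fun j hj => ⟨(T (-t j) : F[T;T⁻¹]) • pauliX j,
      Submodule.smul_mem _ _ (pauliX_mem_xSpace hj), ?_⟩)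
  · rw [Submodule.mem_comap, LinearEquiv.coe_coe, delayEquiv_pauliX]
    exact Submodule.smul_mem _ _ (pauliX_mem_xSpace hj)
  · rw [LinearEquiv.coe_coe, map_smul, delayEquiv_pauliX, smul_smul, ← T_add, neg_add_cancel,
      T_zero, one_smul]

theorem finrank_xSpace (J : Finset ι) : Module.finrank F[T;T⁻¹] (xSpace (F := F) J) = J.card := by
  have hJ : pauliX '' (J : Set ι) =
      Set.range fun j : J => pauliX (A := F[T;T⁻¹]) (Function.Embedding.subtype (· ∈ J) j) :=
    Set.image_eq_range _ _
  rw [xSpace, hJ, finrank_span_eq_card (linearIndependent_pauliX_comp _), Fintype.card_coe]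

theorem rowSpace_trivialX {ρ : Type*} [Fintype ρ] (a : ρ ↪ ι) :
    (Stabilizer.trivialX (F := F) a).rowSpace = xSpace (Finset.univ.map a) := by
  rw [Stabilizer.rowSpace, _root_.funext (row_trivialX a), xSpace, Finset.coe_map, Finset.coe_univ,
    Set.image_univ, ← Set.range_comp]
  rfl

/-- Up to delays, some circuit of depth at most `d` encodes ancillae in eigenstates of their
`X`-operators into the stabilizer `M`. -/
def Encodable (d : ℕ) (M : Submodule F[T;T⁻¹] (PauliRow F ι)) : Prop :=
  ∃ (J : Finset ι) (φ : PauliRow F ι ≃ₗ[F[T;T⁻¹]] PauliRow F ι),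
    Realizable d φ ∧ (xSpace J).map φ.toLinearMap = M

namespace Encodable

variable {d k : ℕ}

theorem mono (hM : Encodable d M) (hd : d ≤ k) : Encodable k M :=
  let ⟨J, φ, hφ, h⟩ := hM
  ⟨J, φ, hφ.mono hd, h⟩

theorem of_map {φ : PauliRow F ι ≃ₗ[F[T;T⁻¹]] PauliRow F ι} (hφ : Implementable k φ)
    (hM : Encodable d (M.map φ.toLinearMap)) : Encodable (d + k) M := by
  obtain ⟨J, ψ, hψ, h⟩ := hM
  refine ⟨J, ψ.trans φ.symm, hψ.trans hφ.2, ?_⟩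
  rw [LinearEquiv.coe_trans, Submodule.map_comp, h, ← Submodule.map_comp, ← LinearEquiv.coe_trans,
    LinearEquiv.self_trans_symm]
  exact Submodule.map_id M

/-- Delays fix the stabilizer of the ancillae, so that they can be dropped. -/
theorem exists_transforms {ρ : Type*} [Finite ρ] {S : Stabilizer F ρ ι}
    (hS : LinearIndependent F[T;T⁻¹] S.row) (h : Encodable d S.rowSpace) :
    ∃ (a : ρ ↪ ι) (c : Circuit F ι), c.Transforms (Stabilizer.trivialX a) S ∧ c.depth ≤ d := by
  have := Fintype.ofFinite ρ
  obtain ⟨J, _, ⟨t, c, hc, rfl⟩, hJ⟩ := h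
  rw [LinearEquiv.coe_trans, Submodule.map_comp, map_delayEquiv_xSpace] at hJ
  have card_eq : Fintype.card ρ = Fintype.card J := by
    rw [Fintype.card_coe, ← finrank_xSpace (F := F), ← LinearEquiv.finrank_map_eq c.equiv, hJ,
      Stabilizer.rowSpace, finrank_span_eq_card hS]
  let e : ρ ≃ J := Fintype.equivOfCardEq card_eq
  refine ⟨e.toEmbedding.trans (.subtype _), c, (c.transforms_iff _ _).2 ?_, hc⟩
  rw [rowSpace_trivialX, ← hJ, ← Finset.map_map, Finset.univ_map_equiv_to_embedding,
    Finset.univ_eq_attach, Finset.attach_map_val]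

end Encodable

variable [Fintype ι]

theorem IsIsotropic.map {k : ℕ} {φ : PauliRow F ι ≃ₗ[F[T;T⁻¹]] PauliRow F ι}
    (hM : IsIsotropic M) (hφ : Implementable k φ) : IsIsotropic (M.map φ.toLinearMap) := by
  rintro _ ⟨x, hx, rfl⟩ _ ⟨y, hy, rfl⟩
  exact (hφ.rowForm_apply x y).trans (hM x hx y hy)

section Constant

variable {W : Finset ι} {u : PhaseSpace F ι}

theorem IsIsotropic.snd_eq_zero (hM : IsIsotropic M) {j : ι} (hj : pauliX j ∈ M)
    (hu : constRow u ∈ M) : u.2 j = 0 := by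
  have h := hM _ hj _ hu
  rw [← constRow_pauliX, rowForm_constRow, symplecticForm_pauliX_left, RingHom.id_apply] at h
  simpa using h

theorem IsIsotropic.exists_eq_add_sum_pauliX (hM : IsIsotropic M) (hW : ∀ j ∉ W, pauliX j ∈ M)
    (hu : constRow u ∈ M) :
    ∃ w, constRow w ∈ M ∧ (∀ i ∉ W, w.1 i = 0 ∧ w.2 i = 0) ∧
      u = w + ∑ j ∈ Wᶜ, u.1 j • pauliX j := by
  refine ⟨u - ∑ j ∈ Wᶜ, u.1 j • pauliX j, ?_, fun i hi => ⟨?_, ?_⟩, (sub_add_cancel _ _).symm⟩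
  · simp only [map_sub, map_sum, constRow_smul, constRow_pauliX]
    exact M.sub_mem hu (M.sum_mem fun j hj => M.smul_mem _ (hW j (Finset.mem_compl.1 hj)))
  · simp [pauliX, Prod.fst_sum, Pi.single_apply, hi]
  · simp [pauliX, Prod.snd_sum, hM.snd_eq_zero (hW i hi) hu]

theorem IsIsotropic.eq_xSpace (hM : IsIsotropic M) (hW : ∀ j ∉ W, pauliX j ∈ M)
    (hgen : M ≤ Submodule.span F[T;T⁻¹] (constRow '' {u | constRow u ∈ M}))
    (h : ∀ w, constRow w ∈ M → (∀ i ∉ W, w.1 i = 0 ∧ w.2 i = 0) → w = 0) : xSpace Wᶜ = M := by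
  refine le_antisymm (xSpace_le.2 fun j hj => hW j (Finset.mem_compl.1 hj))
    (hgen.trans (Submodule.span_le.2 ?_))
  rintro _ ⟨u, hu, rfl⟩
  obtain ⟨w, hwM, hw, huw⟩ := hM.exists_eq_add_sum_pauliX hW hu
  rw [huw, h w hwM hw, zero_add, map_sum]
  refine Submodule.sum_mem _ fun j hj => ?_
  rw [constRow_smul, constRow_pauliX]
  exact Submodule.smul_mem _ _ (pauliX_mem_xSpace hj)

theorem IsIsotropic.encodable_of_le_span_constRow (hM : IsIsotropic M)
    (hW : ∀ j ∉ W, pauliX j ∈ M)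
    (hgen : M ≤ Submodule.span F[T;T⁻¹] (constRow '' {u | constRow u ∈ M})) :
    Encodable ((8 * Fintype.card ι + 3) * W.card) M := by
  induction W using Finset.strongInduction generalizing M with
  | H W ih =>
    by_cases! h : ∀ w, constRow w ∈ M → (∀ i ∉ W, w.1 i = 0 ∧ w.2 i = 0) → w = 0
    · exact ⟨Wᶜ, .refl _ _, (Implementable.refl _).1,
        (Submodule.map_id _).trans (hM.eq_xSpace hW hgen h)⟩
    obtain ⟨u, huM, huW, hu⟩ := h
    obtain ⟨j, hj, σ, hσ, hσu⟩ := exists_isClifford_eq_pauliX hu huW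
    obtain ⟨φ, hφ, hφσ⟩ := hσ.exists_implementable
    have pauliX_mem : ∀ i ∉ W.erase j, pauliX i ∈ M.map φ.toLinearMap := by
      intro i hi
      rcases eq_or_ne i j with rfl | hij
      · exact ⟨constRow u, huM, by rw [LinearEquiv.coe_coe, hφσ, hσu, constRow_pauliX]⟩
      · have hiW : i ∉ W := fun h => hi (Finset.mem_erase.2 ⟨hij, h⟩)
        refine ⟨constRow (pauliX i), constRow_pauliX (F := F) i ▸ hW i hiW, ?_⟩
        rw [LinearEquiv.coe_coe, hφσ, hσ.map_pauliX i hiW, constRow_pauliX]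
    have gen : M.map φ.toLinearMap ≤
        Submodule.span F[T;T⁻¹] (constRow '' {u | constRow u ∈ M.map φ.toLinearMap}) := by
      refine (Submodule.map_mono hgen).trans ?_
      rw [Submodule.map_span, Submodule.span_le]
      rintro _ ⟨_, ⟨v, hv, rfl⟩, rfl⟩
      exact Submodule.subset_span ⟨σ v, ⟨constRow v, hv, hφσ v⟩, (hφσ v).symm⟩
    have h := ih _ (Finset.erase_ssubset hj) (hM.map hφ) pauliX_mem gen
    rw [← Finset.card_erase_add_one hj, mul_add_one]
    exact h.of_map hφ

end Constant

theorem IsIsotropic.encodable_of_degreeLE [Finite F] (hM : IsIsotropic M) (hsat : IsSaturated M)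
    {N : ℕ} (hN : DegreeLE N M) :
    Encodable ((8 * Fintype.card ι + 3) * Fintype.card ι + 60 * Fintype.card ι * N) M := by
  induction N using Nat.strong_induction_on generalizing M with
  | _ N ih =>
    rcases hM.exists_lowersDegree_or_le_span_constRow hsat with ⟨φ, hφ, hlow⟩ | hgen
    · obtain ⟨hpos, hN'⟩ := hN.map hlow
      refine (Encodable.of_map hφ (ih _ (by lia) (hM.map hφ) (hsat.map φ) hN')).mono ?_
      rw [add_assoc, ← mul_add_one, Nat.sub_one_add_one hpos.ne']
    · exact (hM.encodable_of_le_span_constRow (W := Finset.univ)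
        (fun j hj => absurd (Finset.mem_univ j) hj) hgen).mono (Nat.le_add_right _ _)

end Encoding

section NonCatastrophic

variable {F : Type*} [Field F]

theorem exists_eq_coe_iff (s : PowerSeries F) :
    (∃ f : F[X], s = (f : PowerSeries F)) ↔ ∃ N, ∀ n, N ≤ n → PowerSeries.coeff n s = 0 := by
  constructor
  · rintro ⟨f, rfl⟩
    refine ⟨f.natDegree + 1, fun n hn => ?_⟩
    rw [Polynomial.coeff_coe, coeff_eq_zero_of_natDegree_lt hn]
  · rintro ⟨N, hN⟩
    refine ⟨PowerSeries.trunc N s, PowerSeries.ext fun n => ?_⟩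
    rw [Polynomial.coeff_coe, PowerSeries.coeff_trunc]
    split_ifs with hn
    · rfl
    · exact hN n (not_lt.1 hn)

section Dvd

variable {ρ κ : Type*} [Fintype ρ] {G : Matrix ρ κ F[X]}

theorem NonCatastrophic.dvd (hG : NonCatastrophic G) {f : F[X]} (hf : f.coeff 0 ≠ 0)
    {p : ρ → F[X]} (hp : ∀ j, f ∣ ∑ i, p i * G i j) (i : ρ) : f ∣ p i := by
  have mul_inv : (f : PowerSeries F) * (f : PowerSeries F)⁻¹ = 1 :=
    PowerSeries.mul_inv_cancel _ (by simpa using hf)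
  choose q hq using hp
  obtain ⟨h, hh⟩ := hG (fun i => (p i : PowerSeries F) * (f : PowerSeries F)⁻¹) (fun j => ⟨q j, by
    have hqj := congrArg Polynomial.coeToPowerSeries.ringHom (hq j)
    simp only [map_sum, map_mul, Polynomial.coeToPowerSeries.ringHom_apply] at hqj
    rw [Finset.sum_congr rfl fun i _ => mul_right_comm _ _ _, ← Finset.sum_mul, hqj,
      mul_right_comm, mul_inv, one_mul]⟩) i
  refine ⟨h, Polynomial.coe_injective F ?_⟩
  rw [Polynomial.coe_mul, ← hh, mul_left_comm, mul_inv, mul_one]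

theorem NonCatastrophic.linearIndependent (hG : NonCatastrophic G) :
    LinearIndependent F[X] G.row := by
  rw [Fintype.linearIndependent_iff]
  intro p hp i
  have sum_eq_zero (j) : ∑ i, p i * G i j = 0 := by simpa using congrFun hp j
  refine eq_zero_of_dvd_of_natDegree_lt
    (hG.dvd (f := X ^ ((p i).natDegree + 1) + Polynomial.C 1) (by simp)
      (fun j => sum_eq_zero j ▸ dvd_zero _) i) ?_
  rw [natDegree_X_pow_add_C]
  exact Nat.lt_succ_self _

end Dvd

section Extension

variable {K : Type*} [Field K] [Algebra K F]

/-- The coefficientwise application of a linear functional on the extension `F` of `K` to power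
series over `F`. -/
noncomputable def mapCoeff (l : F →ₗ[K] K) : PowerSeries F →ₗ[K] PowerSeries K where
  toFun s := PowerSeries.mk fun n => l (PowerSeries.coeff n s)
  map_add' s t := by ext; simp
  map_smul' a s := by ext; simp

theorem coeff_mapCoeff (l : F →ₗ[K] K) (s : PowerSeries F) (n : ℕ) :
    PowerSeries.coeff n (mapCoeff l s) = l (PowerSeries.coeff n s) :=
  PowerSeries.coeff_mk n fun n => l (PowerSeries.coeff n s)

theorem mapCoeff_mul_coe_map (l : F →ₗ[K] K) (s : PowerSeries F) (f : K[X]) :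
    mapCoeff l (s * (f.map (algebraMap K F) : F[X])) = mapCoeff l s * (f : PowerSeries K) := by
  ext n
  simp only [coeff_mapCoeff, PowerSeries.coeff_mul, Polynomial.coeff_coe, Polynomial.coeff_map,
    map_sum]
  refine Finset.sum_congr rfl fun a _ => ?_
  rw [mul_comm, ← Algebra.smul_def, map_smul, smul_eq_mul, mul_comm]

theorem NonCatastrophic.map [Module.Finite K F] {ρ κ : Type*} [Fintype ρ] {G : Matrix ρ κ K[X]}
    (hG : NonCatastrophic G) : NonCatastrophic (G.map (Polynomial.map (algebraMap K F))) := by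
  intro u hu i
  let b := Module.finBasis K F
  have coord_finite (l) : ∃ f : K[X], mapCoeff (b.coord l) (u i) = f := by
    refine hG (fun k => mapCoeff (b.coord l) (u k)) (fun j => ?_) i
    obtain ⟨N, hN⟩ := (exists_eq_coe_iff _).1 (hu j)
    refine (exists_eq_coe_iff _).2 ⟨N, fun n hn => ?_⟩
    have sum_eq : ∑ k, mapCoeff (b.coord l) (u k) * (G k j : PowerSeries K) =
        mapCoeff (b.coord l) (∑ k, u k * ((G k j).map (algebraMap K F) : F[X])) := by
      rw [map_sum]
      exact Finset.sum_congr rfl fun k _ => (mapCoeff_mul_coe_map _ _ _).symm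
    rw [sum_eq, coeff_mapCoeff]
    exact (congrArg (b.coord l) (hN n hn)).trans (map_zero (b.coord l))
  simp only [exists_eq_coe_iff] at coord_finite ⊢
  choose N hN using coord_finite
  refine ⟨∑ l, N l, fun n hn => b.ext_elem fun l => ?_⟩
  have le_sum : N l ≤ ∑ l, N l :=
    Finset.single_le_sum (fun _ _ => Nat.zero_le _) (Finset.mem_univ l)
  simpa [coeff_mapCoeff] using hN l n (le_sum.trans hn)

end Extension

section Block

theorem nonCatastrophic_of_mul_eq_one {ρ κ : Type*} [Fintype ρ] [DecidableEq ρ] [Fintype κ]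
    {G : Matrix ρ κ F[X]} {B : Matrix κ ρ F[X]} (hB : G * B = 1) : NonCatastrophic G := by
  intro u hu i
  choose f hf using hu
  let φ := Polynomial.coeToPowerSeries.ringHom (R := F)
  have u_eq : u = Matrix.vecMul (fun j => φ (f j)) (B.map φ) := by
    have f_eq : (fun j => φ (f j)) = Matrix.vecMul u (G.map φ) := funext fun j => (hf j).symm
    rw [f_eq, Matrix.vecMul_vecMul, ← Matrix.map_mul, hB,
      Matrix.map_one _ (map_zero φ) (map_one φ), Matrix.vecMul_one]
  refine ⟨Matrix.vecMul f B i, ?_⟩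
  rw [u_eq]
  exact (φ.map_vecMul _ _ _).symm

theorem exists_mul_eq_one_of_linearIndependent_row {ρ κ : Type*} [Finite ρ] [DecidableEq ρ]
    [Fintype κ] {A : Matrix ρ κ F} (hA : LinearIndependent F A.row) :
    ∃ B : Matrix κ ρ F, A * B = 1 := by
  classical
  have := Fintype.ofFinite ρ
  obtain ⟨g, hg⟩ := LinearMap.exists_leftInverse_of_injective A.toLinearMapRight'
    (LinearMap.ker_eq_bot.2 (Matrix.vecMul_injective_iff.2 hA))
  refine ⟨LinearMap.toMatrixRight' g, Matrix.toLinearMapRight'.injective ?_⟩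
  rw [Matrix.toLinearMapRight'_mul, Matrix.toLinearMapRight'_one, ← hg]
  congr 1
  exact LinearMap.toMatrixRight'.symm_apply_apply g

theorem Stabilizer.IsBlock.nonCatastrophic {ρ ι : Type*} [Fintype ρ] [Finite ι]
    {S : Stabilizer F ρ ι} (hS : S.IsBlock) (hli : LinearIndependent F[X] S.toMatrix.row) :
    NonCatastrophic S.toMatrix := by
  classical
  have := Fintype.ofFinite ι
  let A : Matrix ρ (ι ⊕ ι) F := S.toMatrix.map (Polynomial.eval 0)
  have S_eq : S.toMatrix = A.map Polynomial.C := by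
    ext1 i j
    have natDegree_eq : (S.toMatrix i j).natDegree = 0 := by
      rcases j with j | j
      · exact (hS i j).1
      · exact (hS i j).2
    change _ = Polynomial.C (Polynomial.eval 0 (S.toMatrix i j))
    rw [← Polynomial.coeff_zero_eq_eval_zero]
    exact eq_C_of_natDegree_eq_zero natDegree_eq
  have hA : LinearIndependent F A.row := by
    refine LinearIndependent.of_comp ((Algebra.linearMap F F[X]).compLeft (ι ⊕ ι)) ?_
    have hrow := hli.restrict_scalars' F
    rwa [S_eq] at hrow
  obtain ⟨B, hB⟩ := exists_mul_eq_one_of_linearIndependent_row hA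
  refine nonCatastrophic_of_mul_eq_one (B := B.map Polynomial.C) ?_
  rw [S_eq, ← Matrix.map_mul, hB, Matrix.map_one _ (map_zero _) (map_one _)]

end Block

end NonCatastrophic

section RowSpace

variable {F ρ ι : Type*} [Field F]

/-- A row of polynomials, regarded as a row of Laurent polynomials. -/
noncomputable def polyRow : (ι ⊕ ι → F[X]) →ₗ[F[X]] PauliRow F ι where
  toFun ξ := (fun j => toLaurent (ξ (Sum.inl j)), fun j => toLaurent (ξ (Sum.inr j)))
  map_add' ξ η := by ext1 <;> ext1 j <;> exact map_add _ _ _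
  map_smul' f ξ := by ext1 <;> ext1 j <;> exact map_mul _ _ _

theorem polyRow_injective : Function.Injective (polyRow : (ι ⊕ ι → F[X]) → PauliRow F ι) := by
  intro ξ η h
  ext1 j
  rcases j with j | j
  · exact toLaurent_injective (congrFun (congrArg Prod.fst h) j)
  · exact toLaurent_injective (congrFun (congrArg Prod.snd h) j)

theorem toLaurent_smul (f : F[X]) (x : PauliRow F ι) : toLaurent f • x = f • x := by
  rw [← algebraMap_eq_toLaurent, algebraMap_smul]

theorem exists_T_smul_eq_polyRow [Finite ι] (x : PauliRow F ι) :
    ∃ (n : ℕ) (ξ : ι ⊕ ι → F[X]), (T n : F[T;T⁻¹]) • x = polyRow ξ := by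
  obtain ⟨n, hn⟩ := exists_T_smul_mem_posPart x
  rw [mem_posPart] at hn
  choose a ha using fun j => exists_toLaurent_eq (((T n : F[T;T⁻¹]) • x).1 j)
    fun k hk => congrFun (congrArg Prod.fst (hn k hk)) j
  choose b hb using fun j => exists_toLaurent_eq (((T n : F[T;T⁻¹]) • x).2 j)
    fun k hk => congrFun (congrArg Prod.snd (hn k hk)) j
  exact ⟨n, Sum.elim a b, Prod.ext (funext fun j => (ha j).symm) (funext fun j => (hb j).symm)⟩

theorem exists_eq_T_mul_toLaurent {f : F[T;T⁻¹]} (hf : f ≠ 0) :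
    ∃ (n : ℤ) (g : F[X]), f = T n * toLaurent g ∧ g.coeff 0 ≠ 0 := by
  obtain ⟨a, f', hf'⟩ := exists_T_pow f
  have hf'0 : f' ≠ 0 := by
    rintro rfl
    rw [map_zero] at hf'
    exact hf ((isUnit_T (R := F) a).mul_left_eq_zero.1 hf'.symm)
  obtain ⟨g, hg, hXg⟩ := exists_eq_pow_rootMultiplicity_mul_and_not_dvd f' hf'0 0
  rw [Polynomial.C_0, sub_zero] at hg hXg
  refine ⟨rootMultiplicity 0 f' - a, g, (isUnit_T (R := F) a).mul_right_cancel ?_,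
    fun h => hXg (X_dvd_iff.2 h)⟩
  nth_rewrite 1 [← hf', hg]
  rw [map_mul, toLaurent_X_pow, mul_right_comm, ← T_add, sub_add_cancel]

theorem T_smul_mem_iff {E : Type*} [AddCommGroup E] [Module F[T;T⁻¹] E]
    {M : Submodule F[T;T⁻¹] E} (n : ℤ) {x : E} : (T n : F[T;T⁻¹]) • x ∈ M ↔ x ∈ M :=
  ⟨fun h => by simpa [smul_smul, ← T_add, -T_mul] using M.smul_mem (T (-n)) h, M.smul_mem _⟩

namespace Stabilizer

theorem row_eq_polyRow (S : Stabilizer F ρ ι) (i : ρ) : S.row i = polyRow (S.toMatrix.row i) := rfl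

theorem linearIndependent_row {S : Stabilizer F ρ ι}
    (hS : LinearIndependent F[X] S.toMatrix.row) : LinearIndependent F[T;T⁻¹] S.row :=
  (hS.map' polyRow (LinearMap.ker_eq_bot.2 polyRow_injective)).localization F[T;T⁻¹]
    (Submonoid.powers (Polynomial.X : F[X]))

theorem row_mem_rowSpace (S : Stabilizer F ρ ι) (i : ρ) : S.row i ∈ S.rowSpace :=
  Submodule.subset_span ⟨i, rfl⟩

theorem T_smul_row_mem_posPart (S : Stabilizer F ρ ι) (i : ρ) {n : ℤ} (hn : 0 ≤ n) :
    (T n : F[T;T⁻¹]) • S.row i ∈ posPart F ι := mem_posPart.2 fun k hk => by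
  rw [coeffAt_T_smul]
  ext j <;> exact coeff_toLaurent_of_neg _ (by lia)

theorem polyRow_mem_rowSpace_iff [Fintype ρ] {S : Stabilizer F ρ ι} {ξ : ι ⊕ ι → F[X]} :
    polyRow ξ ∈ S.rowSpace ↔
      ∃ (n : ℕ) (p : ρ → F[X]), ∑ i, p i • S.toMatrix.row i = (Polynomial.X : F[X]) ^ n • ξ := by
  constructor
  · intro h
    obtain ⟨g, hg⟩ := (Submodule.mem_span_range_iff_exists_fun _).1 h
    obtain ⟨⟨_, n, rfl⟩, hn⟩ :=
      IsLocalization.exist_integer_multiples_of_finite (Submonoid.powers (Polynomial.X : F[X])) g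
    choose p hp using hn
    refine ⟨n, p, polyRow_injective ?_⟩
    rw [map_sum, map_smul, ← hg, Finset.smul_sum]
    refine Finset.sum_congr rfl fun i _ => ?_
    rw [map_smul, ← row_eq_polyRow, ← algebraMap_smul F[T;T⁻¹] (p i), hp, smul_assoc]
  · rintro ⟨n, p, hp⟩
    rw [← T_smul_mem_iff n, ← toLaurent_X_pow, toLaurent_smul, ← map_smul, ← hp, map_sum]
    refine Submodule.sum_mem _ fun i _ => ?_
    rw [map_smul, ← row_eq_polyRow, ← toLaurent_smul]
    exact S.rowSpace.smul_mem _ (S.row_mem_rowSpace i)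

theorem isSaturated_rowSpace [Fintype ρ] [Finite ι] {S : Stabilizer F ρ ι}
    (hS : NonCatastrophic S.toMatrix) : IsSaturated S.rowSpace := by
  intro f x hf hfx
  obtain ⟨_, g, rfl, hg⟩ := exists_eq_T_mul_toLaurent hf
  obtain ⟨m, ξ, hξ⟩ := exists_T_smul_eq_polyRow x
  rw [mul_smul, T_smul_mem_iff, ← T_smul_mem_iff m, smul_comm, hξ, toLaurent_smul, ← map_smul,
    polyRow_mem_rowSpace_iff] at hfx
  obtain ⟨n, p, hp⟩ := hfx
  rw [smul_comm] at hp
  have sum_eq (j) : ∑ i, p i * S.toMatrix i j = g * ((Polynomial.X : F[X]) ^ n * ξ j) := by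
    simpa only [Finset.sum_apply, Pi.smul_apply, smul_eq_mul, Matrix.row_apply] using congrFun hp j
  have g_dvd (i) : g ∣ p i := hS.dvd hg (fun j => ⟨_, sum_eq j⟩) i
  choose h hh using g_dvd
  simp only [hh, mul_smul, ← Finset.smul_sum] at hp
  have hg0 : g ≠ 0 := by
    rintro rfl
    exact hg (Polynomial.coeff_zero 0)
  rw [← T_smul_mem_iff m, hξ, polyRow_mem_rowSpace_iff]
  exact ⟨n, h, smul_right_injective _ hg0 hp⟩

theorem SelfOrthogonal.isIsotropic [Fintype ι] {S : Stabilizer F ρ ι} (hS : S.SelfOrthogonal) :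
    IsIsotropic S.rowSpace := by
  have rowForm_row (i j) : rowForm (S.row i) (S.row j) = 0 := hS i j
  have rowForm_left {x} (hx : x ∈ S.rowSpace) (j) : rowForm x (S.row j) = 0 := by
    induction hx using Submodule.span_induction with
    | mem x hx =>
      obtain ⟨i, rfl⟩ := hx
      exact rowForm_row i j
    | zero => rw [map_zero, LinearMap.zero_apply]
    | add x y _ _ hx hy => rw [map_add, LinearMap.add_apply, hx, hy, add_zero]
    | smul f x _ hx => rw [map_smul, LinearMap.smul_apply, hx, smul_zero]
  intro x hx y hy
  induction hy using Submodule.span_induction with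
  | mem y hy =>
    obtain ⟨j, rfl⟩ := hy
    exact rowForm_left hx j
  | zero => rw [map_zero]
  | add y z _ _ hy hz => rw [map_add, hy, hz, add_zero]
  | smul f y _ hy => rw [map_smulₛₗ, hy, smul_zero]

end Stabilizer

theorem span_range_T : Submodule.span F (Set.range (T : ℤ → F[T;T⁻¹])) = ⊤ := by
  refine Submodule.eq_top_iff'.2 fun f => ?_
  induction f using LaurentPolynomial.induction_on' with
  | add p q hp hq => exact add_mem hp hq
  | C_mul_T n a =>
    rw [← LaurentPolynomial.smul_eq_C_mul]
    exact Submodule.smul_mem _ a (Submodule.subset_span ⟨n, rfl⟩)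

theorem finrank_quotient_le_card {K E κ : Type*} [Field K] [AddCommGroup E] [Module K E]
    [Fintype κ] {N : Submodule K E} {v : κ → E} (h : N ⊔ Submodule.span K (Set.range v) = ⊤) :
    Module.Finite K (E ⧸ N) ∧ Module.finrank K (E ⧸ N) ≤ Fintype.card κ := by
  have span_eq_top : Submodule.span K (Set.range (N.mkQ ∘ v)) = ⊤ := by
    have hmap := congrArg (Submodule.map N.mkQ) h
    rwa [Submodule.map_sup, Submodule.mkQ_map_self, bot_sup_eq, Submodule.map_span,
      ← Set.range_comp, Submodule.map_top, Submodule.range_mkQ] at hmap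
  exact ⟨⟨span_eq_top ▸ Submodule.fg_span (Set.finite_range _)⟩,
    finrank_le_of_span_eq_top span_eq_top⟩

namespace Stabilizer

section RowDegree

variable [Fintype ι] (S : Stabilizer F ρ ι)

/-- The contribution of row `i` to the constraint length: the maximal degree of its entries. -/
def rowDegree (i : ρ) : ℕ := Finset.univ.sup fun j => max (S.X i j).natDegree (S.Z i j).natDegree

theorem natDegree_le_rowDegree (i : ρ) (j : ι) :
    (S.X i j).natDegree ≤ S.rowDegree i ∧ (S.Z i j).natDegree ≤ S.rowDegree i :=
  max_le_iff.1 (Finset.le_sup (f := fun j => max (S.X i j).natDegree (S.Z i j).natDegree)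
    (Finset.mem_univ j))

theorem row_mem_supportedOn (i : ρ) :
    S.row i ∈ supportedOn (Set.Icc 0 (S.rowDegree i : ℤ)) := by
  have coeff_eq_zero {f : F[X]} (hf : f.natDegree ≤ S.rowDegree i) {k : ℤ}
      (hk : k ∉ Set.Icc 0 (S.rowDegree i : ℤ)) : (toLaurent f).coeff k = 0 := by
    rw [Set.mem_Icc] at hk
    rcases lt_or_ge k 0 with hk0 | hk0
    · exact coeff_toLaurent_of_neg f hk0
    · lift k to ℕ using hk0
      rw [coeff_toLaurent_natCast, coeff_eq_zero_of_natDegree_lt (by lia)]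
  refine mem_supportedOn.2 fun k hk => ?_
  ext j
  · exact coeff_eq_zero (S.natDegree_le_rowDegree i j).1 hk
  · exact coeff_eq_zero (S.natDegree_le_rowDegree i j).2 hk

theorem T_smul_row_mem_negPart (i : ρ) {n : ℤ} (hn : n < -S.rowDegree i) :
    (T n : F[T;T⁻¹]) • S.row i ∈ negPart F ι := mem_negPart.2 fun k hk => by
  rw [coeffAt_T_smul, mem_supportedOn.1 (S.row_mem_supportedOn i) _ (by rw [Set.mem_Icc]; lia)]

/-- The shifts of the rows that have both negative and nonnegative powers of `D`. -/
noncomputable def straddlingRow (s : Σ i, Fin (S.rowDegree i)) : S.rowSpace :=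
  ⟨(T (-(s.2 + 1 : ℤ)) : F[T;T⁻¹]) • S.row s.1, S.rowSpace.smul_mem _ (S.row_mem_rowSpace s.1)⟩

theorem splitPart_sup_span_straddlingRow :
    splitPart S.rowSpace ⊔ Submodule.span F (Set.range S.straddlingRow) = ⊤ := by
  set N := splitPart S.rowSpace ⊔ Submodule.span F (Set.range S.straddlingRow)
  have shift_mem (n : ℤ) (i : ρ) : (T n : F[T;T⁻¹]) • S.row i ∈
      N.map (S.rowSpace.subtype.restrictScalars F) := by
    refine ⟨⟨_, S.rowSpace.smul_mem _ (S.row_mem_rowSpace i)⟩, ?_, rfl⟩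
    rcases le_or_gt 0 n with h0 | h0
    · exact Submodule.mem_sup_left (Submodule.mem_sup_left (S.T_smul_row_mem_posPart i h0))
    rcases lt_or_ge n (-S.rowDegree i) with hd | hd
    · exact Submodule.mem_sup_left (Submodule.mem_sup_right (S.T_smul_row_mem_negPart i hd))
    refine Submodule.mem_sup_right (Submodule.subset_span
      ⟨⟨i, (-n - 1).toNat, by lia⟩, Subtype.ext ?_⟩)
    have hn : -(((-n - 1).toNat : ℤ) + 1) = n := by lia
    simp only [straddlingRow, hn]
  have rowSpace_le : S.rowSpace.restrictScalars F ≤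
      N.map (S.rowSpace.subtype.restrictScalars F) := by
    change (Submodule.span _ (Set.range S.row)).restrictScalars F ≤ _
    rw [← Submodule.span_smul_of_span_eq_top span_range_T, Submodule.span_le]
    rintro _ ⟨_, ⟨n, rfl⟩, _, ⟨i, rfl⟩, rfl⟩
    exact shift_mem n i
  refine Submodule.eq_top_iff'.2 fun x => ?_
  obtain ⟨y, hy, hyx⟩ := rowSpace_le x.2
  rwa [← Subtype.ext hyx]

theorem degreeLE [Fintype ρ] : DegreeLE S.constraintLength S.rowSpace := by
  have h := finrank_quotient_le_card S.splitPart_sup_span_straddlingRow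
  simp only [Fintype.card_sigma, Fintype.card_fin] at h
  exact h

end RowDegree

theorem exists_transforms_trivialX [Finite F] [Fintype ρ] [Fintype ι] [DecidableEq ι]
    {S : Stabilizer F ρ ι} (hS : NonCatastrophic S.toMatrix) (hS' : S.SelfOrthogonal) :
    ∃ (a : ρ ↪ ι) (c : Circuit F ι), c.Transforms (trivialX a) S ∧
      c.depth ≤ 71 * Fintype.card ι ^ 2 * (S.constraintLength + 1) := by
  obtain ⟨a, c, hc, depth_le⟩ := Encodable.exists_transforms
    (linearIndependent_row hS.linearIndependent)
    (hS'.isIsotropic.encodable_of_degreeLE (isSaturated_rowSpace hS) S.degreeLE)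
  refine ⟨a, c, hc, depth_le.trans ?_⟩
  generalize Fintype.card ι = n
  generalize S.constraintLength = N
  have n_le : n ≤ n ^ 2 := Nat.le_self_pow two_ne_zero n
  have nN_le : n * N ≤ n ^ 2 * N := Nat.mul_le_mul_right N n_le
  nlinarith

end Stabilizer

end RowSpace

section Copies

variable {F ι κ : Type*} [Field F]

/-- The components of a row on the qudits `f i`. -/
noncomputable def restrictRow (f : ι → κ) : PauliRow F κ →ₗ[F[T;T⁻¹]] PauliRow F ι :=
  (LinearMap.funLeft F[T;T⁻¹] F[T;T⁻¹] f).prodMap (LinearMap.funLeft F[T;T⁻¹] F[T;T⁻¹] f)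

theorem restrictRow_apply (f : ι → κ) (v : PauliRow F κ) :
    restrictRow f v = (v.1 ∘ f, v.2 ∘ f) := rfl

section RestrictMap

variable [DecidableEq ι] [DecidableEq κ] (f : ι ↪ κ)

theorem Gate.restrictRow_act_map (g : Gate F ι) (v : PauliRow F κ) :
    restrictRow f ((g.map f).act v) = g.act (restrictRow f v) := by
  cases g <;> simp [restrictRow_apply, Gate.map, Gate.act,
    Function.update_comp_eq_of_injective _ f.injective, -T_mul]

theorem Layer.restrictRow_act_map (L : Layer F ι) (v : PauliRow F κ) :
    restrictRow f ((L.map f).act v) = L.act (restrictRow f v) := by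
  simp only [Layer.act, Layer.map]
  induction L.gates generalizing v with
  | nil => rfl
  | cons g l ih => simp only [List.map_cons, List.foldl_cons, ih, Gate.restrictRow_act_map]

theorem Circuit.restrictRow_act_map (c : Circuit F ι) (v : PauliRow F κ) :
    restrictRow f ((c.map f).act v) = c.act (restrictRow f v) := by
  simp only [Circuit.act, Circuit.map]
  induction c generalizing v with
  | nil => rfl
  | cons L c ih => simp only [List.map_cons, List.foldl_cons, ih, Layer.restrictRow_act_map]

end RestrictMap

section RestrictDisjoint

variable [DecidableEq κ] {σ : Type*} {f : ι ↪ κ} {h : σ → κ}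

theorem Gate.restrictRow_act_map_of_disjoint (hf : Disjoint (Set.range h) (Set.range f))
    (g : Gate F ι) (v : PauliRow F κ) : restrictRow h ((g.map f).act v) = restrictRow h v := by
  have h_ne (s i) : h s ≠ f i := Set.disjoint_range_iff.1 hf s i
  cases g <;> ext1 <;> ext1 s <;>
    simp [restrictRow_apply, Gate.map, Gate.act, h_ne]

theorem Layer.restrictRow_act_map_of_disjoint (hf : Disjoint (Set.range h) (Set.range f))
    (L : Layer F ι) (v : PauliRow F κ) : restrictRow h ((L.map f).act v) = restrictRow h v := by
  simp only [Layer.act, Layer.map]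
  induction L.gates generalizing v with
  | nil => rfl
  | cons g l ih =>
    simp only [List.map_cons, List.foldl_cons, ih, Gate.restrictRow_act_map_of_disjoint hf]

theorem Circuit.restrictRow_act_map_of_disjoint (hf : Disjoint (Set.range h) (Set.range f))
    (c : Circuit F ι) (v : PauliRow F κ) : restrictRow h ((c.map f).act v) = restrictRow h v := by
  simp only [Circuit.act, Circuit.map]
  induction c generalizing v with
  | nil => rfl
  | cons L c ih =>
    simp only [List.map_cons, List.foldl_cons, ih, Layer.restrictRow_act_map_of_disjoint hf]

end RestrictDisjoint

section FlatMap

variable {α : Type*} {f : α → ι ↪ κ} (c : Circuit F ι)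

theorem Circuit.restrictRow_act_flatMap_of_disjoint [DecidableEq κ] {σ : Type*} {h : σ → κ}
    {l : List α} (hf : ∀ j ∈ l, Disjoint (Set.range h) (Set.range (f j))) (v : PauliRow F κ) :
    restrictRow h (Circuit.act (l.flatMap fun j => c.map (f j)) v) = restrictRow h v := by
  induction l generalizing v with
  | nil => rfl
  | cons a l ih =>
    rw [List.forall_mem_cons] at hf
    rw [List.flatMap_cons, act_append, ih hf.2, restrictRow_act_map_of_disjoint hf.1]

theorem Circuit.restrictRow_act_flatMap [DecidableEq ι] [DecidableEq κ]
    (hf : Pairwise fun j j' => Disjoint (Set.range (f j)) (Set.range (f j'))) {l : List α}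
    (hl : l.Nodup) {j : α} (hj : j ∈ l) (v : PauliRow F κ) :
    restrictRow (f j) (Circuit.act (l.flatMap fun j => c.map (f j)) v) =
      c.act (restrictRow (f j) v) := by
  induction l generalizing v with
  | nil => exact absurd hj List.not_mem_nil
  | cons a l ih =>
    rw [List.nodup_cons] at hl
    rw [List.flatMap_cons, act_append]
    rcases List.mem_cons.1 hj with rfl | hjl
    · rw [restrictRow_act_flatMap_of_disjoint c
        fun j' hj' => hf (ne_of_mem_of_not_mem hj' hl.1).symm, restrictRow_act_map]
    · rw [ih hl.2 hjl, restrictRow_act_map_of_disjoint (hf (ne_of_mem_of_not_mem hjl hl.1))]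

theorem Gate.duration_map (f : ι ↪ κ) (g : Gate F ι) : (g.map f).duration = g.duration := by
  cases g <;> rfl

theorem Layer.duration_map (f : ι ↪ κ) (L : Layer F ι) : (L.map f).duration = L.duration := by
  simp only [duration, map, List.map_map, Function.comp_def, Gate.duration_map]

theorem Circuit.depth_map (f : ι ↪ κ) : (c.map f).depth = c.depth := by
  simp only [depth, map, List.map_map, Function.comp_def, Layer.duration_map]

theorem Circuit.depth_flatMap (f : α → ι ↪ κ) (l : List α) :
    Circuit.depth (l.flatMap fun j => c.map (f j)) = l.length * c.depth := by
  induction l with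
  | nil => exact (zero_mul _).symm
  | cons a l ih =>
    rw [List.flatMap_cons, depth_append, depth_map, ih, List.length_cons, Nat.succ_mul, add_comm]

end FlatMap

namespace Circuit

variable {r n : ℕ} (a : Fin r ↪ κ) (c : Circuit F ι)

open Function.Embedding (sectL sectR)

theorem depth_strandCopies : (c.strandCopies a).depth = r * c.depth := by
  rw [strandCopies, depth_flatMap, List.length_finRange]

theorem depth_blockCopies : (c.blockCopies n).depth = n * c.depth := by
  rw [blockCopies, depth_flatMap, List.length_finRange]

variable [DecidableEq ι]

theorem restrictRow_sectL_act_strandCopies [DecidableEq κ] (j : Fin r) (v : PauliRow F (ι × κ)) :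
    restrictRow (sectL ι (a j)) ((c.strandCopies a).act v) =
      c.act (restrictRow (sectL ι (a j)) v) :=
  restrictRow_act_flatMap (f := fun j => sectL ι (a j)) c
    (fun _ _ hj => Set.disjoint_range_iff.2 fun _ _ h => hj (a.injective (congrArg Prod.snd h)))
    (List.nodup_finRange r) (List.mem_finRange j) v

theorem restrictRow_sectL_act_strandCopies_of_notMem [DecidableEq κ] {k : κ} (hk : k ∉ Set.range a)
    (v : PauliRow F (ι × κ)) :
    restrictRow (sectL ι k) ((c.strandCopies a).act v) = restrictRow (sectL ι k) v :=
  restrictRow_act_flatMap_of_disjoint (h := sectL ι k) (f := fun j => sectL ι (a j)) c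
    (fun j _ => Set.disjoint_range_iff.2 fun _ _ h => hk ⟨j, congrArg Prod.snd h.symm⟩) v

theorem restrictRow_sectR_act_blockCopies (b : Fin n) (v : PauliRow F (Fin n × ι)) :
    restrictRow (sectR b ι) ((c.blockCopies n).act v) = c.act (restrictRow (sectR b ι) v) :=
  restrictRow_act_flatMap (f := fun b => sectR b ι) c
    (fun _ _ hb => Set.disjoint_range_iff.2 fun _ _ h => hb (congrArg Prod.fst h))
    (List.nodup_finRange n) (List.mem_finRange b) v

end Circuit

end Copies

section Fourier

variable {F ι : Type*} [Field F] [Fintype ι]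

/-- The Fourier transform on all qudits of the frame. -/
noncomputable def dftLayer (F ι : Type*) [Field F] [Fintype ι] : Layer F ι where
  gates := Finset.univ.toList.map Gate.dft
  disjoint := List.Pairwise.map _ (fun _ _ => Set.disjoint_singleton.2)
    (Finset.nodup_toList Finset.univ)

theorem duration_dftLayer_le : (dftLayer F ι).duration ≤ 1 := by
  simp only [Layer.duration, dftLayer]
  induction (Finset.univ : Finset ι).toList with
  | nil => exact Nat.zero_le _
  | cons i l ih => exact max_le le_rfl ih

theorem Circuit.depth_dftLayer_cons_le (c : Circuit F ι) :
    Circuit.depth (dftLayer F ι :: c) ≤ 1 + c.depth := by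
  rw [depth, List.map_cons, List.sum_cons]
  exact Nat.add_le_add_right duration_dftLayer_le _

variable [DecidableEq ι]

omit [Fintype ι] in
theorem foldl_act_dft {l : List ι} (hl : l.Nodup) (v : PauliRow F ι) :
    (l.map Gate.dft).foldl (fun w g => g.act w) v =
      (fun i => if i ∈ l then v.2 i else v.1 i, fun i => if i ∈ l then -v.1 i else v.2 i) := by
  induction l generalizing v with
  | nil => rfl
  | cons a l ih =>
    rw [List.nodup_cons] at hl
    rw [List.map_cons, List.foldl_cons, ih hl.2]
    ext1 <;> ext1 i <;> by_cases h : i = a <;> by_cases h' : i ∈ l <;>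
      simp_all [Gate.act]

theorem act_dftLayer (v : PauliRow F ι) : (dftLayer F ι).act v = (v.2, -v.1) := by
  simp only [Layer.act, dftLayer, foldl_act_dft (Finset.nodup_toList Finset.univ),
    Finset.mem_toList, Finset.mem_univ, if_true]
  rfl

theorem Circuit.Transforms.dftLayer_cons {ρ : Type*} {a : ρ ↪ ι} {c : Circuit F ι}
    {S : Stabilizer F ρ ι} (hc : c.Transforms (Stabilizer.trivialX a) S) :
    Circuit.Transforms (dftLayer F ι :: c) (Stabilizer.trivialZ a) S := by
  have act_row (i) : Circuit.act (dftLayer F ι :: c) ((Stabilizer.trivialZ a).row i) =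
      c.act ((Stabilizer.trivialX a).row i) := by
    change c.act ((dftLayer F ι).act _) = _
    rw [act_dftLayer, row_trivialZ, row_trivialX]
    simp only [pauliZ, pauliX, neg_zero]
  rw [Transforms, ← hc]
  simp only [act_row]

end Fourier

section Product

variable {F ι κ : Type*} [Field F]

open Function.Embedding (sectL sectR)

/-- The row `(g ⊗ x | g ⊗ z)`. -/
noncomputable def tensorRow :
    (ι → F[T;T⁻¹]) →ₗ[F[T;T⁻¹]] PauliRow F κ →ₗ[F[T;T⁻¹]] PauliRow F (ι × κ) :=
  LinearMap.mk₂ _ (fun g h => (fun q => g q.1 * h.1 q.2, fun q => g q.1 * h.2 q.2))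
    (fun g g' h => by ext1 <;> ext1 q <;> simp [add_mul])
    (fun f g h => by ext1 <;> ext1 q <;> simp [mul_assoc])
    (fun g h h' => by ext1 <;> ext1 q <;> simp [mul_add])
    (fun f g h => by ext1 <;> ext1 q <;> simp [mul_left_comm])

theorem tensorRow_apply (g : ι → F[T;T⁻¹]) (h : PauliRow F κ) :
    tensorRow g h = (fun q => g q.1 * h.1 q.2, fun q => g q.1 * h.2 q.2) := rfl

theorem restrictRow_sectL_tensorRow (g : ι → F[T;T⁻¹]) (h : PauliRow F κ) (k : κ) :
    restrictRow (sectL ι k) (tensorRow g h) = (h.1 k • g, h.2 k • g) := by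
  ext1 <;> ext1 i <;> exact mul_comm _ _

theorem restrictRow_sectR_tensorRow (g : ι → F[T;T⁻¹]) (h : PauliRow F κ) (i : ι) :
    restrictRow (sectR i κ) (tensorRow g h) = g i • h := rfl

theorem restrictRow_sectL_pauliZ [DecidableEq ι] [DecidableEq κ] (b : ι) (j k : κ) :
    restrictRow (sectL ι k) (pauliZ (b, j) : PauliRow F (ι × κ)) =
      if k = j then pauliZ b else 0 := by
  by_cases hk : k = j <;> ext1 <;> ext1 i <;>
    simp [restrictRow_apply, pauliZ, Pi.single_apply, hk]

theorem ext_restrictRow_sectL {v w : PauliRow F (ι × κ)}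
    (h : ∀ k, restrictRow (sectL ι k) v = restrictRow (sectL ι k) w) : v = w := by
  ext1 <;> ext1 ⟨i, k⟩
  · exact congrFun (congrArg Prod.fst (h k)) i
  · exact congrFun (congrArg Prod.snd (h k)) i

theorem ext_restrictRow_sectR {v w : PauliRow F (ι × κ)}
    (h : ∀ i, restrictRow (sectR i κ) v = restrictRow (sectR i κ) w) : v = w := by
  ext1 <;> ext1 ⟨i, k⟩
  · exact congrFun (congrArg Prod.fst (h i)) k
  · exact congrFun (congrArg Prod.snd (h i)) k

namespace Circuit

variable [DecidableEq κ]

theorem act_strandCopies_pauliZ [DecidableEq ι] {r : ℕ} (a : Fin r ↪ κ) {c : Circuit F ι} {b : ι}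
    (hc : (c.act (pauliZ b)).2 = 0) (j : Fin r) :
    (c.strandCopies a).act (pauliZ (b, a j)) = tensorRow (c.act (pauliZ b)).1 (pauliX (a j)) := by
  refine ext_restrictRow_sectL fun k => ?_
  rw [restrictRow_sectL_tensorRow]
  by_cases hk : k ∈ Set.range a
  · obtain ⟨j', rfl⟩ := hk
    rw [restrictRow_sectL_act_strandCopies, restrictRow_sectL_pauliZ]
    by_cases hj : a j' = a j
    · rw [if_pos hj, hj]
      simp [pauliX, Prod.ext_iff, hc]
    · rw [if_neg hj, ← equiv_apply, map_zero]
      simp [pauliX, Prod.ext_iff, hj]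
  · have hkj : k ≠ a j := fun h => hk ⟨j, h.symm⟩
    rw [restrictRow_sectL_act_strandCopies_of_notMem a c hk, restrictRow_sectL_pauliZ, if_neg hkj]
    simp [pauliX, Prod.ext_iff, hkj]

theorem act_blockCopies_tensorRow {n : ℕ} (d : Circuit F κ) (g : Fin n → F[T;T⁻¹])
    (v : PauliRow F κ) : (d.blockCopies n).act (tensorRow g v) = tensorRow g (d.act v) := by
  refine ext_restrictRow_sectR fun b => ?_
  rw [restrictRow_sectR_act_blockCopies, restrictRow_sectR_tensorRow, restrictRow_sectR_tensorRow,
    ← equiv_apply, ← equiv_apply, map_smul]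

end Circuit

section RowSpace

variable {K ρ : Type*} [Field K] [Algebra K F] (G : Matrix ρ ι K[X])

theorem rowSpace_ofX_le_ker_snd :
    (Stabilizer.ofX (F := F) G).rowSpace ≤ LinearMap.ker (LinearMap.snd _ _ _) := by
  refine Submodule.span_le.2 ?_
  rintro _ ⟨i, rfl⟩
  exact LinearMap.mem_ker.2 (_root_.funext fun _ => map_zero toLaurent)

theorem rowSpace_product {σ : Type*} (S : Stabilizer F σ κ) :
    (Stabilizer.product G S).rowSpace =
      Submodule.map₂ tensorRow
        ((Stabilizer.ofX (F := F) G).rowSpace.map (LinearMap.fst _ _ _)) S.rowSpace := by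
  rw [Stabilizer.rowSpace, Stabilizer.rowSpace, Stabilizer.rowSpace, Submodule.map_span,
    ← Set.range_comp, Submodule.map₂_span_span, Set.image2_range]
  congr 2
  ext1 ⟨i, j⟩
  ext1 <;> ext1 q <;>
    simp [Stabilizer.row, Stabilizer.product, Stabilizer.ofX, tensorRow_apply]

end RowSpace

theorem Circuit.transforms_product {K : Type*} [Field K] [Algebra K F] {n r k : ℕ} [DecidableEq κ]
    {a₁ : Fin k ↪ Fin n} {a₂ : Fin r ↪ κ} {c : Circuit F (Fin n)} {d : Circuit F κ}
    {G : Matrix (Fin k) (Fin n) K[X]} {S : Stabilizer F (Fin r) κ}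
    (hc : c.Transforms (Stabilizer.trivialZ a₁) (Stabilizer.ofX G))
    (hd : d.Transforms (Stabilizer.trivialX a₂) S) :
    Circuit.Transforms (c.strandCopies a₂ ++ d.blockCopies n)
      (Stabilizer.trivialZ (a₁.prodMap a₂)) (Stabilizer.product G S) := by
  have act_mem (i) : c.act (pauliZ (a₁ i)) ∈ (Stabilizer.ofX (F := F) G).rowSpace := by
    rw [← hc]
    exact Submodule.subset_span ⟨i, congrArg c.act (row_trivialZ a₁ i)⟩
  have act_snd (i) : (c.act (pauliZ (a₁ i))).2 = 0 :=
    LinearMap.mem_ker.1 (rowSpace_ofX_le_ker_snd G (act_mem i))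
  rw [Transforms, rowSpace_product, ← hc, ← hd, Submodule.map_span, ← Set.range_comp,
    Submodule.map₂_span_span, Set.image2_range]
  congr 2
  ext1 ⟨i, j⟩
  rw [act_append, row_trivialZ, row_trivialX, Function.comp_apply, row_trivialZ]
  change act _ (act _ (pauliZ (a₁ i, a₂ j))) = _
  rw [act_strandCopies_pauliZ a₂ (act_snd i), act_blockCopies_tensorRow]
  rfl

section ConstraintLength

variable [Fintype ι] [Fintype κ] {K ρ σ : Type*} [Field K] [Algebra K F]

theorem natDegree_le_natDegree_map_mul {f : K[X]} (hf : f ≠ 0) (s : F[X]) :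
    s.natDegree ≤ (f.map (algebraMap K F) * s).natDegree := by
  rcases eq_or_ne s 0 with rfl | hs
  · simp
  · rw [natDegree_mul ((Polynomial.map_ne_zero_iff (algebraMap K F).injective).2 hf) hs]
    exact Nat.le_add_left _ _

theorem natDegree_map_le_natDegree_map_mul (f : K[X]) {s : F[X]} (hs : s ≠ 0) :
    (f.map (algebraMap K F)).natDegree ≤ (f.map (algebraMap K F) * s).natDegree := by
  rcases eq_or_ne (f.map (algebraMap K F)) 0 with hf | hf
  · simp [hf]
  · rw [natDegree_mul hf hs]
    exact Nat.le_add_right _ _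

theorem rowDegree_ofX_le (G : Matrix ρ ι K[X]) {S : Stabilizer F σ κ} {j : σ}
    (hj : S.toMatrix.row j ≠ 0) (i : ρ) :
    (Stabilizer.ofX (F := F) G).rowDegree i ≤ (Stabilizer.product G S).rowDegree (i, j) := by
  obtain ⟨k, hk⟩ := Function.ne_iff.1 hj
  refine Finset.sup_le fun b _ => max_le ?_ (natDegree_zero.trans_le (Nat.zero_le _))
  rcases k with k | k
  · exact (natDegree_map_le_natDegree_map_mul _ hk).trans
      ((Stabilizer.product G S).natDegree_le_rowDegree (i, j) (b, k)).1
  · exact (natDegree_map_le_natDegree_map_mul _ hk).trans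
      ((Stabilizer.product G S).natDegree_le_rowDegree (i, j) (b, k)).2

theorem rowDegree_le_product {G : Matrix ρ ι K[X]} (S : Stabilizer F σ κ) {i : ρ}
    (hi : G.row i ≠ 0) (j : σ) : S.rowDegree j ≤ (Stabilizer.product G S).rowDegree (i, j) := by
  obtain ⟨b, hb⟩ := Function.ne_iff.1 hi
  refine Finset.sup_le fun k _ => ?_
  have le_rowDegree := (Stabilizer.product G S).natDegree_le_rowDegree (i, j) (b, k)
  exact max_le ((natDegree_le_natDegree_map_mul hb _).trans le_rowDegree.1)
    ((natDegree_le_natDegree_map_mul hb _).trans le_rowDegree.2)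

variable [Fintype ρ] [Fintype σ]

theorem constraintLength_ofX_le (G : Matrix ρ ι K[X]) {S : Stabilizer F σ κ} {j : σ}
    (hj : S.toMatrix.row j ≠ 0) :
    (Stabilizer.ofX (F := F) G).constraintLength ≤ (Stabilizer.product G S).constraintLength := calc
  _ ≤ ∑ i, (Stabilizer.product G S).rowDegree (i, j) :=
    Finset.sum_le_sum fun i _ => rowDegree_ofX_le G hj i
  _ ≤ ∑ i, ∑ j', (Stabilizer.product G S).rowDegree (i, j') :=
    Finset.sum_le_sum fun i _ => Finset.single_le_sum
      (f := fun j' => (Stabilizer.product G S).rowDegree (i, j'))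
      (fun _ _ => Nat.zero_le _) (Finset.mem_univ j)
  _ = (Stabilizer.product G S).constraintLength := (Fintype.sum_prod_type _).symm

theorem constraintLength_le_product {G : Matrix ρ ι K[X]} (S : Stabilizer F σ κ) {i : ρ}
    (hi : G.row i ≠ 0) :
    S.constraintLength ≤ (Stabilizer.product G S).constraintLength := calc
  _ ≤ ∑ j, (Stabilizer.product G S).rowDegree (i, j) :=
    Finset.sum_le_sum fun j _ => rowDegree_le_product S hi j
  _ ≤ ∑ j, ∑ i', (Stabilizer.product G S).rowDegree (i', j) :=
    Finset.sum_le_sum fun j _ => Finset.single_le_sum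
      (f := fun i' => (Stabilizer.product G S).rowDegree (i', j))
      (fun _ _ => Nat.zero_le _) (Finset.mem_univ i)
  _ = (Stabilizer.product G S).constraintLength := (Fintype.sum_prod_type_right _).symm

end ConstraintLength

theorem NonCatastrophic.ofX {K ρ : Type*} [Field K] [Algebra K F] [Module.Finite K F] [Fintype ρ]
    {G : Matrix ρ ι K[X]} (hG : NonCatastrophic G) :
    NonCatastrophic (Stabilizer.ofX (F := F) G).toMatrix :=
  fun u hu => hG.map u fun j => hu (Sum.inl j)

theorem selfOrthogonal_ofX {K ρ : Type*} [Field K] [Algebra K F] [Fintype ι]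
    (G : Matrix ρ ι K[X]) : (Stabilizer.ofX (F := F) G).SelfOrthogonal := by
  intro i j
  simp [Stabilizer.ofX]

end Product

theorem depth_copies_le {r n₁ n₂ N c d₁ d₂ : ℕ} (hn₁ : 0 < n₁) (hr : r ≤ n₂)
    (hd₁ : 0 < r → d₁ ≤ 1 + c * n₁ ^ 2 * N) (hd₂ : d₂ ≤ c * n₂ ^ 2 * N) :
    r * d₁ + n₁ * d₂ ≤ n₁ * n₂ + 2 * c * (n₁ * n₂) ^ 2 * N := by
  have strands_le : r * d₁ ≤ n₁ * n₂ + c * (n₁ * n₂) ^ 2 * N := by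
    rcases r.eq_zero_or_pos with rfl | hr0
    · rw [zero_mul]
      exact Nat.zero_le _
    calc r * d₁ ≤ n₂ * 1 + n₂ ^ 2 * (c * n₁ ^ 2 * N) :=
          (Nat.mul_le_mul hr (hd₁ hr0)).trans ((mul_add _ _ _).trans_le
            (Nat.add_le_add_left (Nat.mul_le_mul_right _ (Nat.le_self_pow two_ne_zero n₂)) _))
      _ ≤ n₁ * n₂ + n₂ ^ 2 * (c * n₁ ^ 2 * N) :=
          Nat.add_le_add_right ((mul_one n₂).trans_le (Nat.le_mul_of_pos_left n₂ hn₁)) _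
      _ = n₁ * n₂ + c * (n₁ * n₂) ^ 2 * N := by ring
  have blocks_le : n₁ * d₂ ≤ c * (n₁ * n₂) ^ 2 * N := calc
    n₁ * d₂ ≤ n₁ ^ 2 * (c * n₂ ^ 2 * N) := Nat.mul_le_mul (Nat.le_self_pow two_ne_zero n₁) hd₂
    _ = c * (n₁ * n₂) ^ 2 * N := by ring
  linarith

end QConv

theorem mainTheorem2_general {K F : Type*} [Field K] [Field F] [Finite F] [Algebra K F]
    {k₁ n₁ r n₂ : ℕ} {G₁ : Matrix (Fin k₁) (Fin n₁) K[X]} {S₂ : Stabilizer F (Fin r) (Fin n₂)}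
    (hk₁ : 0 < k₁) (hG₁ : NonCatastrophic G₁) (hS₂ : S₂.IsQCC)
    (hS₂' : S₂.IsBlock ∨ NonCatastrophic S₂.toMatrix) :
    ∃ (a₁ : Fin k₁ ↪ Fin n₁) (a₂ : Fin r ↪ Fin n₂)
      (CC : Circuit F (Fin n₁)) (BC : Circuit F (Fin n₂)),
      CC.Transforms (Stabilizer.trivialZ a₁) (Stabilizer.ofX G₁) ∧
      BC.Transforms (Stabilizer.trivialX a₂) S₂ ∧
      (CC.strandCopies a₂ ++ BC.blockCopies n₁).Transforms
        (Stabilizer.trivialZ (a₁.prodMap a₂)) (Stabilizer.product G₁ S₂) ∧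
      Circuit.depth (CC.strandCopies a₂ ++ BC.blockCopies n₁) ≤
        n₁ * n₂ + 142 * (n₁ * n₂) ^ 2 * ((Stabilizer.product G₁ S₂).constraintLength + 1) := by
  have hS : NonCatastrophic S₂.toMatrix := hS₂'.elim (fun h => h.nonCatastrophic hS₂.1) id
  obtain ⟨a₂, BC, hBC, depth_BC⟩ := Stabilizer.exists_transforms_trivialX hS hS₂.2
  obtain ⟨a₁, c, hc, depth_c⟩ :=
    Stabilizer.exists_transforms_trivialX (hG₁.ofX (F := F)) (selfOrthogonal_ofX G₁)
  have k₁_le : k₁ ≤ n₁ := by simpa using Fintype.card_le_of_embedding a₁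
  have r_le : r ≤ n₂ := by simpa using Fintype.card_le_of_embedding a₂
  refine ⟨a₁, a₂, dftLayer F _ :: c, BC, hc.dftLayer_cons, hBC,
    Circuit.transforms_product hc.dftLayer_cons hBC, ?_⟩
  rw [Circuit.depth_append, Circuit.depth_strandCopies, Circuit.depth_blockCopies]
  rw [Fintype.card_fin] at depth_BC depth_c
  refine depth_copies_le (c := 71) (hk₁.trans_le k₁_le) r_le (fun hr => ?_) (depth_BC.trans ?_)
  · refine (Circuit.depth_dftLayer_cons_le c).trans (Nat.add_le_add_left (depth_c.trans ?_) 1)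
    gcongr
    exact constraintLength_ofX_le G₁ (hS.linearIndependent.ne_zero ⟨0, hr⟩)
  · gcongr
    exact constraintLength_le_product S₂ (hG₁.linearIndependent.ne_zero ⟨0, hk₁⟩)

theorem mainTheorem2 :
    ∃ P : MvPolynomial (Fin 2) ℕ,
      ∀ (p : ℕ) [Fact p.Prime] (F : Type*) [Field F] [Finite F] [Algebra (ZMod p) F]
        (k₁ n₁ r n₂ : ℕ) (G₁ : Matrix (Fin k₁) (Fin n₁) (ZMod p)[X])
        (S₂ : Stabilizer F (Fin r) (Fin n₂)),
        0 < k₁ → NonCatastrophic G₁ → DelayFree G₁ →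
        S₂.IsQCC → (S₂.IsBlock ∨ NonCatastrophic S₂.toMatrix) →
        ∃ (a₁ : Fin k₁ ↪ Fin n₁) (a₂ : Fin r ↪ Fin n₂)
          (CC : Circuit F (Fin n₁)) (BC : Circuit F (Fin n₂)),
          CC.Transforms (Stabilizer.trivialZ a₁) (Stabilizer.ofX G₁) ∧
          BC.Transforms (Stabilizer.trivialX a₂) S₂ ∧
          (CC.strandCopies a₂ ++ BC.blockCopies n₁).Transforms
            (Stabilizer.trivialZ (a₁.prodMap a₂)) (Stabilizer.product G₁ S₂) ∧
          Circuit.depth (CC.strandCopies a₂ ++ BC.blockCopies n₁) ≤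
            MvPolynomial.eval ![n₁ * n₂, (Stabilizer.product G₁ S₂).constraintLength] P := by
  refine ⟨MvPolynomial.X 0 + 142 * MvPolynomial.X 0 ^ 2 * (MvPolynomial.X 1 + 1), ?_⟩
  intro p _ F _ _ _ k₁ n₁ r n₂ G₁ S₂ hk₁ hG₁ _ hS₂ hS₂'
  simpa using mainTheorem2_general hk₁ hG₁ hS₂ hS₂'
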